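/- Setting. Let $G$ be a finite multigraph whose propagators are all massless, with external momenta $p_1,\dots,p_K,q_1,\dots,q_M$ attached to its vertices. Consider the on-shell expansion of wide-angle scattering: the momenta depend on a scaling variable $\lambda\to0^+$, sum to zero, and satisfy $p_i^2\sim\lambda$, $q_j^2\sim1$, $p_k\cdot p_l\sim1$ for $k\ne l$, and they are non-exceptional: $(\sum_{\ell\in I}\ell)^2\sim1$ for every set $I$ of external momenta such that $I$ and its complement both have at least two elements. For a spanning 2-tree $T^2$ let $s_{T^2}$ be the square of the external momentum flowing into either of its components, and let $$\mathcal P=\mathcal U+\mathcal F,\qquad \mathcal U=\sum_{T^1}\prod_{e\notin T^1}x_e,\qquad \mathcal F=-\sum_{T^2}s_{T^2}\prod_{e\notin T^2}x_e$$ be the Lee-Pomeransky polynomial ($T^1$ runs over the spanning trees and $T^2$ over the spanning 2-trees of $G$). Regions. A region $R$ assigns to each edge one of the modes hard, collinear to $p_i$, or soft. A vertex is in $S$ if it has at least one edge and all its edges are soft; it is in $J_i$ if it has at least one edge collinear to $p_i$ and all its other edges are collinear to $p_i$ or soft; all other vertices are in $H$. Together with the edges of the respective mode this partitions $G$ into subgraphs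 $H$, $J_1,\dots,J_K$, $S$ (an edge can belong to a subgraph that does not contain its endpoints), and it is required that: $H$ is nonempty and connected and all $q_j$ are attached to it; each $J_i$, unless it is empty, is connected, is attached to $H$, and has $p_i$ as its only external momentum; $S$ has no external momenta, and each of its connected components $S_1,\dots,S_n$ is attached to $H\cup J_1\cup\dots\cup J_K$. For $\gamma=J_i$ or $\gamma=S_k$, the contracted graph $\widetilde\gamma$ is obtained from $\gamma$ by identifying all endpoints of edges of $\gamma$ that lie outside $\gamma$ with one auxiliary vertex. $L(\cdot)$ denotes the number of loops. Leading monomials. Put $u_e=0,-1,-2$ for $e$ hard, jet, soft respectively. A monomial $\boldsymbol x^{\hat{\boldsymbol r}}$ of $\mathcal P$ with coefficient of order $\lambda^{r_{N+1}}$ is leading if it minimises $\hat{\boldsymbol r}\cdot\boldsymbol u+r_{N+1}$ among all monomials of $\mathcal P$; each monomial comes from a unique spanning tree or 2-tree $T$. The leading monomials are of the following types: - $\mathcal U^{(R)}$: $T$ is a spanning tree; - $\mathcal F^{(p_i^2,R)}$: $T$ is a spanning 2-tree one of whose components has $p_i$ as its only external momentum; - $\mathcal F_{\mathrm I}^{(q^2,R)}$: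 $T$ is a spanning 2-tree, $s_T\sim1$, and $H\cap T$ is a spanning 2-tree of $H$; - $\mathcal F_{\mathrm{II}}^{(q_{ij}^2,R)}$, $i\neq j$: $T$ is a spanning 2-tree, $s_T\sim1$, $H\cap T$ is a spanning tree of $H$, and the component of $T$ disjoint from $H$ has external momenta exactly $p_i$ and $p_j$ (so $q_{ij}=p_i+p_j$). Claim. Every leading monomial is of one of these types, and the numbers $n_H$, $n_{J_l}$, $n_{S_k}$ of parameters $x_e$ with $e$ in $H$, $J_l$, $S_k$ that it contains are as follows, for all $l=1,\dots,K$ and $k=1,\dots,n$: - $\mathcal U^{(R)}$: $n_H=L(H)$, $n_{J_l}=L(\widetilde J_l)$, $n_{S_k}=L(\widetilde S_k)$; - $\mathcal F^{(p_i^2,R)}$: $n_H=L(H)$, $n_{J_i}=L(\widetilde J_i)+1$, $n_{J_l}=L(\widetilde J_l)$ for $l\ne i$, $n_{S_k}=L(\widetilde S_k)$; - $\mathcal F_{\mathrm I}^{(q^2,R)}$: $n_H=L(H)+1$, $n_{J_l}=L(\widetilde J_l)$, $n_{S_k}=L(\widetilde S_k)$; - $\mathcal F_{\mathrm{II}}^{(q_{ij}^2,R)}$: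 $n_H=L(H)$, $n_{J_i}=L(\widetilde J_i)+1$, $n_{J_j}=L(\widetilde J_j)+1$, $n_{J_l}=L(\widetilde J_l)$ for $l\ne i,j$, and there is exactly one component $S_{k[i,j]}$ of $S$ that contains edges of the path in $T$ joining $p_i$ and $p_j$; it has $n_{S_{k[i,j]}}=L(\widetilde S_{k[i,j]})-1$, and $n_{S_k}=L(\widetilde S_k)$ for all $k\ne k[i,j]$. -/

import Mathlib

namespace WideAngle

open Filter Asymptotics Topology

noncomputable section

/-! ### Multigraphs: components, loops, spanning forests -/

section Multigraphs

variable {α β : Type*}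

open scoped Graph

/-- The vertices that can be reached from `x` along edges of `G`. -/
def component (G : Graph α β) (x : α) : Set α := {y | Relation.ReflTransGen G.Adj x y}

/-- The set of (vertex sets of) connected components of `G`. -/
def components (G : Graph α β) : Set (Set α) := component G '' V(G)

/-- The number of independent loops of `G`: edges minus vertices plus connected components. -/
def loops (G : Graph α β) : ℤ :=
  (E(G).ncard : ℤ) - (V(G).ncard : ℤ) + ((components G).ncard : ℤ)

/-- `G` has no cycle: every edge is a bridge (so there are no self-loops, no multiple edges). -/
def IsForest (G : Graph α β) : Prop :=
  ∀ e x y, G.IsLink e x y → y ∉ component (G.deleteEdges {e}) x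

/-- The edge set `T` is a spanning `k`-tree of `G`: a forest on all vertices of `G` with exactly
`k` connected components. A spanning tree is the case `k = 1`. -/
def IsSpanningKTree (k : ℕ) (G : Graph α β) (T : Set β) : Prop :=
  T ⊆ E(G) ∧ IsForest (G.restrict T) ∧ (components (G.restrict T)).ncard = k

/-! ### Subgraphs that may contain an edge without containing its endpoints

Such a subgraph is a set of vertices (`Sum.inl`) and edges (`Sum.inr`). -/

/-- The incidence relation between the vertices and the edges of `G`, as a simple graph. -/
def incidence (G : Graph α β) : SimpleGraph (α ⊕ β) :=
  SimpleGraph.fromRel fun a b => ∃ v e, a = Sum.inl v ∧ b = Sum.inr e ∧ G.Inc e v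

/-- The vertices of a subgraph. -/
def verts (γ : Set (α ⊕ β)) : Set α := {v | Sum.inl v ∈ γ}

/-- The edges of a subgraph. -/
def edges (γ : Set (α ⊕ β)) : Set β := {e | Sum.inr e ∈ γ}

/-- `γ` is nonempty and connected, through vertices and edges of `γ` only. -/
def IsConnected (G : Graph α β) (γ : Set (α ⊕ β)) : Prop := ((incidence G).induce γ).Connected

/-- `σ` is a connected component of the subgraph `γ`. -/
def IsComponentOf (G : Graph α β) (γ σ : Set (α ⊕ β)) : Prop :=
  ∃ c : ((incidence G).induce γ).ConnectedComponent, σ = Subtype.val '' c.supp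

/-- `γ` is attached to `δ`: an edge of one of them has an endpoint in the other. -/
def IsAttached (G : Graph α β) (γ δ : Set (α ⊕ β)) : Prop :=
  ∃ a ∈ γ, ∃ b ∈ δ, (incidence G).Adj a b

/-- The graph with the vertices of `γ` and those edges of `γ` whose endpoints are in `γ`. -/
def toGraph (G : Graph α β) (γ : Set (α ⊕ β)) : Graph α β :=
  (G.induce (verts γ)).restrict (edges γ)

open Classical in
/-- The contracted graph `γ̃`: its edges are those of `γ`, and all vertices outside `γ` are
identified with one auxiliary vertex `none`. -/
def contracted (G : Graph α β) (γ : Set (α ⊕ β)) : Graph (Option α) β :=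
  (G.restrict (edges γ)).map fun v => if v ∈ verts γ then some v else none

end Multigraphs

/-! ### Kinematics -/

/-- The external legs: `Sum.inl i` carries the nearly on-shell momentum `p_i`, and `Sum.inr j`
the off-shell momentum `q_j`. -/
abbrev Leg (K M : ℕ) : Type := Fin K ⊕ Fin M

/-- Momenta in Minkowski space with `d` space dimensions. -/
abbrev Momentum (d : ℕ) : Type := Fin (d + 1) → ℝ

/-- The Minkowski product `k · l`. -/
def mdot {d : ℕ} (k l : Momentum d) : ℝ := k 0 * l 0 - ∑ a : Fin d, k a.succ * l a.succ

/-- The invariant square `k²`. -/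
def msq {d : ℕ} (k : Momentum d) : ℝ := mdot k k

/-- The real function `f` of the scaling variable `t > 0` scales as `t ^ n` when `t → 0`. -/
def ScalesAs (f : ℝ → ℝ) (n : ℕ) : Prop := f =Θ[𝓝[>] 0] fun t => t ^ n

/-- The on-shell limit in wide-angle kinematics: a family of external momenta, depending on the
scaling variable `t`, such that all `p_i ^ 2` are of order `t` and all other Lorentz invariants
are of order `1`. -/
structure IsWideAngle {d K M : ℕ} (P : Leg K M → ℝ → Momentum d) : Prop where
  conservation : ∀ t : ℝ, 0 < t → ∑ l, P l t = 0
  on_shell : ∀ i : Fin K, ScalesAs (fun t => msq (P (Sum.inl i) t)) 1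
  off_shell : ∀ j : Fin M, ScalesAs (fun t => msq (P (Sum.inr j) t)) 0
  wide_angle : ∀ k l : Fin K, k ≠ l →
    ScalesAs (fun t => mdot (P (Sum.inl k) t) (P (Sum.inl l) t)) 0
  non_exceptional : ∀ I : Finset (Leg K M), 2 ≤ I.card → 2 ≤ Iᶜ.card →
    ScalesAs (fun t => msq (∑ l ∈ I, P l t)) 0

section Polynomial

variable {α β : Type*} {d K M : ℕ}

open scoped Graph

/-- The external legs that are attached to a vertex in `C`. -/
def legsIn (attach : Leg K M → α) (C : Set α) : Set (Leg K M) := {l | attach l ∈ C}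

open Classical in
/-- The total external momentum that flows into the vertex set `C`. -/
def momentumInto (attach : Leg K M → α) (P : Leg K M → ℝ → Momentum d) (C : Set α) (t : ℝ) :
    Momentum d :=
  ∑ l with l ∈ legsIn attach C, P l t

/-- The square `s_T` of the momentum that flows into each of the two components of the spanning
2-tree `T`. By momentum conservation the two components give the same value, and it is written
as their mean. -/
def momentumSq (G : Graph α β) (attach : Leg K M → α) (P : Leg K M → ℝ → Momentum d)
    (T : Set β) (t : ℝ) : ℝ :=
  (∑ᶠ C ∈ components (G.restrict T), msq (momentumInto attach P C t)) / 2

variable [Fintype β]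

open Classical in
/-- The exponent vector of the monomial `∏ x_e`, with `e` running over the edges not in `T`. -/
def complExp (G : Graph α β) (T : Finset β) : β →₀ ℕ :=
  ∑ e with e ∈ E(G) ∧ e ∉ T, Finsupp.single e 1

open Classical in
/-- The first Symanzik polynomial. -/
def symanzikU (G : Graph α β) : MvPolynomial β ℝ :=
  ∑ T ∈ Finset.univ.filter (fun T : Finset β => IsSpanningKTree 1 G (T : Set β)),
    MvPolynomial.monomial (complExp G T) 1

open Classical in
/-- The second Symanzik polynomial, for massless propagators and the kinematics at `t`. -/
def symanzikF (G : Graph α β) (attach : Leg K M → α) (P : Leg K M → ℝ → Momentum d) (t : ℝ) :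
    MvPolynomial β ℝ :=
  -∑ T ∈ Finset.univ.filter (fun T : Finset β => IsSpanningKTree 2 G (T : Set β)),
    MvPolynomial.monomial (complExp G T) (momentumSq G attach P T t)

/-- The Lee-Pomeransky polynomial. -/
def leePomeransky (G : Graph α β) (attach : Leg K M → α) (P : Leg K M → ℝ → Momentum d) (t : ℝ) :
    MvPolynomial β ℝ :=
  symanzikU G + symanzikF G attach P t

/-- `(m; n)` is an exponent vector of the Lee-Pomeransky polynomial: the monomial `x ^ m` has a
coefficient that scales as `t ^ n`. -/
def IsExponent (G : Graph α β) (attach : Leg K M → α) (P : Leg K M → ℝ → Momentum d)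
    (m : β →₀ ℕ) (n : ℕ) : Prop :=
  ScalesAs (fun t => (leePomeransky G attach P t).coeff m) n

/-- The product of the exponent vector `(m; n)` with the vector `(u; 1)`. -/
def weight (u : β → ℤ) (m : β →₀ ℕ) (n : ℕ) : ℤ := ∑ e, (m e : ℤ) * u e + n

/-- The monomial `x ^ m` is one of the leading monomials of the Lee-Pomeransky polynomial under
`x → t ^ u x`: it has the smallest power of `t`. -/
def IsLeading (G : Graph α β) (attach : Leg K M → α) (P : Leg K M → ℝ → Momentum d)
    (u : β → ℤ) (m : β →₀ ℕ) : Prop :=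
  ∃ n, IsExponent G attach P m n ∧
    ∀ m' n', IsExponent G attach P m' n' → weight u m n ≤ weight u m' n'

open Classical in
/-- The number of parameters `x_e`, `e ∈ γ`, in the monomial `x ^ m`. -/
def numIn (γ : Set (α ⊕ β)) (m : β →₀ ℕ) : ℕ := ∑ e with e ∈ edges γ, m e

end Polynomial

/-! ### Hard, jet and soft subgraphs -/

/-- The momentum mode of a propagator: hard, collinear to `p_i`, or soft. -/
inductive Mode (K : ℕ) : Type
  | hard : Mode K
  | jet (i : Fin K) : Mode K
  | soft : Mode K

/-- The entry of the region vector for a propagator of the given mode. -/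
def Mode.exponent {K : ℕ} : Mode K → ℤ
  | hard => 0
  | jet _ => -1
  | soft => -2

section Regions

variable {α β : Type*} {d K M : ℕ}

open scoped Graph

/-- The vertices that connect to soft edges only. -/
def softVerts (G : Graph α β) (mode : β → Mode K) : Set α :=
  {v | v ∈ V(G) ∧ (∃ e, G.Inc e v) ∧ ∀ e, G.Inc e v → mode e = Mode.soft}

/-- The vertices that connect to at least one edge of the `i`-th jet, and otherwise only to edges
of the `i`-th jet and soft edges. -/
def jetVerts (G : Graph α β) (mode : β → Mode K) (i : Fin K) : Set α :=
  {v | v ∈ V(G) ∧ (∃ e, G.Inc e v ∧ mode e = Mode.jet i) ∧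
    ∀ e, G.Inc e v → mode e = Mode.jet i ∨ mode e = Mode.soft}

/-- All other vertices. -/
def hardVerts (G : Graph α β) (mode : β → Mode K) : Set α :=
  {v | v ∈ V(G) ∧ v ∉ softVerts G mode ∧ ∀ i, v ∉ jetVerts G mode i}

/-- The hard subgraph `H`. -/
def hardPart (G : Graph α β) (mode : β → Mode K) : Set (α ⊕ β) :=
  Sum.inl '' hardVerts G mode ∪ Sum.inr '' {e | e ∈ E(G) ∧ mode e = Mode.hard}

/-- The jet subgraph `J_i`. -/
def jetPart (G : Graph α β) (mode : β → Mode K) (i : Fin K) : Set (α ⊕ β) :=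
  Sum.inl '' jetVerts G mode i ∪ Sum.inr '' {e | e ∈ E(G) ∧ mode e = Mode.jet i}

/-- The soft subgraph `S`. -/
def softPart (G : Graph α β) (mode : β → Mode K) : Set (α ⊕ β) :=
  Sum.inl '' softVerts G mode ∪ Sum.inr '' {e | e ∈ E(G) ∧ mode e = Mode.soft}

/-- `σ` is one of the connected components `S_k` of the soft subgraph. -/
def IsSoftComponent (G : Graph α β) (mode : β → Mode K) (σ : Set (α ⊕ β)) : Prop :=
  IsComponentOf G (softPart G mode) σ

/-- The requirements on the subgraphs `H`, `J_1, …, J_K`, `S` of a region. A jet may be empty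
(then `p_i` enters the hard subgraph directly), and there may be no soft edges. -/
structure IsRegion (G : Graph α β) (attach : Leg K M → α) (mode : β → Mode K) : Prop where
  hard_connected : IsConnected G (hardPart G mode)
  hard_momenta : ∀ j : Fin M, attach (Sum.inr j) ∈ hardVerts G mode
  jet_connected : ∀ i, (jetPart G mode i).Nonempty → IsConnected G (jetPart G mode i)
  jet_attached : ∀ i, (jetPart G mode i).Nonempty →
    IsAttached G (jetPart G mode i) (hardPart G mode)
  jet_momentum : ∀ i, (jetPart G mode i).Nonempty → attach (Sum.inl i) ∈ jetVerts G mode i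
  jet_only_momentum : ∀ i l, attach l ∈ jetVerts G mode i → l = Sum.inl i
  soft_momenta : ∀ l, attach l ∉ softVerts G mode
  soft_attached : ∀ σ, IsSoftComponent G mode σ →
    IsAttached G σ (hardPart G mode ∪ ⋃ i, jetPart G mode i)

/-- The entries of the region vector. -/
def regionVector (mode : β → Mode K) (e : β) : ℤ := (mode e).exponent

variable [Fintype β]

/-! ### The four types of leading monomials -/

/-- The monomial of `T` is a `U^(R)` term. -/
def IsUTerm (G : Graph α β) (attach : Leg K M → α) (P : Leg K M → ℝ → Momentum d)
    (mode : β → Mode K) (T : Finset β) : Prop :=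
  IsLeading G attach P (regionVector mode) (complExp G T) ∧ IsSpanningKTree 1 G T

/-- The monomial of `T` is an `F^(p_i², R)` term: a leading monomial of a spanning 2-tree one
component of which has `p_i` as its only external momentum. -/
def IsFpTerm (G : Graph α β) (attach : Leg K M → α) (P : Leg K M → ℝ → Momentum d)
    (mode : β → Mode K) (i : Fin K) (T : Finset β) : Prop :=
  IsLeading G attach P (regionVector mode) (complExp G T) ∧ IsSpanningKTree 2 G T ∧
    ∃ C ∈ components (G.restrict T), legsIn attach C = {Sum.inl i}

/-- The monomial of `T` is an `F^(q², R)` term: a leading monomial of a spanning 2-tree with a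
kinematic factor of order `1`. -/
def IsFqTerm (G : Graph α β) (attach : Leg K M → α) (P : Leg K M → ℝ → Momentum d)
    (mode : β → Mode K) (T : Finset β) : Prop :=
  IsLeading G attach P (regionVector mode) (complExp G T) ∧ IsSpanningKTree 2 G T ∧
    ScalesAs (momentumSq G attach P T) 0

/-- The monomial of `T` is an `F_I^(q², R)` term: the restriction of `T` to `H` is a spanning
2-tree of `H`. -/
def IsFITerm (G : Graph α β) (attach : Leg K M → α) (P : Leg K M → ℝ → Momentum d)
    (mode : β → Mode K) (T : Finset β) : Prop :=
  IsFqTerm G attach P mode T ∧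
    IsSpanningKTree 2 (toGraph G (hardPart G mode)) (T ∩ edges (hardPart G mode))

/-- The monomial of `T` is an `F_II^(q_ij², R)` term: the restriction of `T` to `H` is a spanning
tree of `H`, and the external momenta of the component of `T` disjoint from `H` are `p_i` and
`p_j`, so that `q_ij = p_i + p_j` flows between the two components. -/
def IsFIITerm (G : Graph α β) (attach : Leg K M → α) (P : Leg K M → ℝ → Momentum d)
    (mode : β → Mode K) (i j : Fin K) (T : Finset β) : Prop :=
  IsFqTerm G attach P mode T ∧
    IsSpanningKTree 1 (toGraph G (hardPart G mode)) (T ∩ edges (hardPart G mode)) ∧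
    ∃ C ∈ components (G.restrict T), Disjoint C (hardVerts G mode) ∧
      legsIn attach C = {Sum.inl i, Sum.inl j}

/-- `σ` contains an edge of the path in the forest `T` that joins the external momenta `p_i` and
`p_j`: an edge of `T` without which they are not joined any more. -/
def ContainsPathEdge (G : Graph α β) (attach : Leg K M → α) (T : Finset β) (i j : Fin K)
    (σ : Set (α ⊕ β)) : Prop :=
  attach (Sum.inl j) ∈ component (G.restrict T) (attach (Sum.inl i)) ∧
    ∃ e ∈ T, e ∈ edges σ ∧
      attach (Sum.inl j) ∉ component (G.restrict (T \ {e})) (attach (Sum.inl i))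

end Regions

end

end WideAngle

/-! Up to a constant, the weight of the monomial of a forest `T` with `c` components and kinematic
order `n` is `2|T| - |T ∩ low| - |T ∩ H| + n`, where "low" means hard or jet, since `-u_e = 2 - [e
low] - [e hard]` (`weight_complExp`). As `|T| = |V| - c`, a leading `T` must have many low and many
hard edges. Comparison with a minimum spanning tree, built greedily from hard, then jet, then soft
edges, gives (`IsLeading.bound`) `n + |V_low| + |V_H| ≤ 2c + |T ∩ low| + |T ∩ H|`.

In the other direction, the edges of a forest inside a vertex set `W` number at most `|W|` minus the
number of values on `W` of any function constant along them (`ncard_add_ncard_image_le_of_subset`).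
With components of `T` as values, a spanning tree, and a 2-tree both of whose components meet `H`,
must saturate the bounds for `H` and for the low part, and `n = 0`. If a component `C` of a 2-tree
avoids `H`, low edges inside `C` cannot pass from one jet to another, because jets touch only at
`H`. If `C` meets `k` jets, then `|T ∩ low| ≤ |V_low| - 1 - k`, hence `n + k ≤ 2`. Since `C` carries
some external momentum and all its legs sit in the jets that it meets, either `k = n = 1` with one
leg `p_i`, or `k = 2`, `n = 0` with two legs `p_i`, `p_j` (`classification_of_disjoint`). All
inequalities are equalities again.

Saturated totals force each jet and each soft component to saturate its own bound (`jet_count`,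
`soft_count`). For `k = 2` the low part has one edge fewer than its two components would allow; the
missing edge reappears in exactly one soft component (`soft_count_excess`), which is the one that
connects the two jets (`exists_pathEdge_iff`). The loop numbers are `|E| - |V| + 1` for `H` and `|E|
- |V|` for the contracted jets and soft components, so these edge counts are the claim. -/

namespace WideAngle

open Filter Asymptotics Topology

noncomputable section

/-! ### Forests and spanning trees -/

section Forests

variable {α β γ : Type*} {G : Graph α β} {A B T : Set β} {x y z u v : α} {e : β}

open scoped Graph

/-- The vertices `x` and `y` are joined by edges in `A`. -/
def Joined (G : Graph α β) (A : Set β) (x y : α) : Prop :=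
  Relation.ReflTransGen (G.restrict A).Adj x y

theorem mem_component_iff : y ∈ component (G.restrict A) x ↔ Joined G A x y := Iff.rfl

theorem Joined.refl (x : α) : Joined G A x x := Relation.ReflTransGen.refl

theorem Joined.trans (h : Joined G A x y) (h' : Joined G A y z) : Joined G A x z :=
  Relation.ReflTransGen.trans h h'

theorem Joined.symm (h : Joined G A x y) : Joined G A y x :=
  Relation.ReflTransGen.stdSymm.symm _ _ h

theorem Joined.of_isLink (h : G.IsLink e x y) (he : e ∈ A) : Joined G A x y :=
  Relation.ReflTransGen.single ⟨e, by simp [h, he]⟩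

theorem Joined.of_inc (hx : G.Inc e x) (hy : G.Inc e y) (he : e ∈ A) : Joined G A x y := by
  obtain ⟨z, hz⟩ := hx
  obtain rfl | rfl := hy.eq_or_eq_of_isLink hz
  · exact .refl _
  · exact .of_isLink hz he

theorem Joined.eq_of_forall_isLink {g : α → γ} (h : Joined G A x y)
    (hg : ∀ e ∈ A, ∀ a b, G.IsLink e a b → g a = g b) : g x = g y := by
  induction h with
  | refl => rfl
  | tail _ h ih =>
    obtain ⟨e, he⟩ := h
    simp only [Graph.restrict_isLink] at he
    exact ih.trans (hg e he.1 _ _ he.2)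

theorem Joined.of_forall_isLink (h : Joined G A x y)
    (hB : ∀ e ∈ A, ∀ a b, G.IsLink e a b → Joined G B a b) : Joined G B x y := by
  induction h with
  | refl => exact .refl _
  | tail _ h ih =>
    obtain ⟨e, he⟩ := h
    simp only [Graph.restrict_isLink] at he
    exact ih.trans (hB e he.1 _ _ he.2)

theorem Joined.mono (h : Joined G A x y) (hAB : A ⊆ B) : Joined G B x y :=
  h.of_forall_isLink fun _ he _ _ hl => .of_isLink hl (hAB he)

/-- A walk through `e` can be shortened so that it uses `e` at most once. Hence one more edge merges
at most two classes. -/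
theorem Joined.of_insert (h : Joined G (insert e A) x y) (huv : G.IsLink e u v) :
    Joined G A x y ∨ (Joined G A x u ∧ Joined G A v y) ∨ (Joined G A x v ∧ Joined G A u y) := by
  induction h with
  | refl => exact .inl (.refl _)
  | @tail b c _ h ih =>
    obtain ⟨f, hf⟩ := h
    simp only [Graph.restrict_isLink, Set.mem_insert_iff] at hf
    by_cases hfA : f ∈ A
    · have hbc : Joined G A b c := .of_isLink (by tauto) hfA
      rcases ih with h | ⟨h, h'⟩ | ⟨h, h'⟩
      · exact .inl (h.trans hbc)
      · exact .inr (.inl ⟨h, h'.trans hbc⟩)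
      · exact .inr (.inr ⟨h, h'.trans hbc⟩)
    · obtain rfl : f = e := by tauto
      have hl : G.IsLink f b c := by tauto
      rcases huv.eq_and_eq_or_eq_and_eq hl with ⟨rfl, rfl⟩ | ⟨rfl, rfl⟩
      · rcases ih with h | ⟨h, h'⟩ | ⟨h, h'⟩
        · exact .inr (.inl ⟨h, .refl _⟩)
        · exact .inr (.inl ⟨h, .refl _⟩)
        · exact .inl h
      · rcases ih with h | ⟨h, h'⟩ | ⟨h, h'⟩
        · exact .inr (.inr ⟨h, .refl _⟩)
        · exact .inl h
        · exact .inr (.inr ⟨h, .refl _⟩)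

theorem component_restrict_eq_iff :
    component (G.restrict A) x = component (G.restrict A) y ↔ Joined G A x y := by
  constructor
  · intro h
    have : y ∈ component (G.restrict A) y := Joined.refl y
    rwa [← h] at this
  · intro h
    ext z
    exact ⟨fun hz => h.symm.trans hz, fun hz => h.trans hz⟩

theorem mem_components_restrict {C : Set α} :
    C ∈ components (G.restrict A) ↔ ∃ x ∈ V(G), component (G.restrict A) x = C := by
  simp [components]

theorem component_eq_of_mem {C : Set α} (hC : C ∈ components (G.restrict A)) (hx : x ∈ C) :
    component (G.restrict A) x = C := by
  obtain ⟨y, -, rfl⟩ := mem_components_restrict.1 hC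
  exact component_restrict_eq_iff.2 (Joined.symm hx)

theorem isForest_restrict_iff :
    IsForest (G.restrict T) ↔ ∀ e ∈ T, ∀ x y, G.IsLink e x y → ¬ Joined G (T \ {e}) x y := by
  have key : ∀ e x, component ((G.restrict T).deleteEdges {e}) x
      = component (G.restrict (T \ {e})) x := by
    intro e x
    have : ((G.restrict T).deleteEdges {e}).Adj = (G.restrict (T \ {e})).Adj := by
      ext a b
      simp only [Graph.Adj, Graph.deleteEdges_isLink, Graph.restrict_isLink, Set.mem_sdiff]
      exact exists_congr fun _ => by tauto
    simp only [component, this]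
  simp only [IsForest, key, mem_component_iff, Graph.restrict_isLink]
  exact ⟨fun h e he x y hl => h e x y (by tauto), fun h e x y hl => h e (by tauto) x y (by tauto)⟩

theorem isForest_restrict_mono (hT : IsForest (G.restrict T)) (hA : A ⊆ T) :
    IsForest (G.restrict A) := by
  rw [isForest_restrict_iff] at *
  exact fun e he x y hl h => hT e (hA he) x y hl (h.mono (Set.sdiff_subset_sdiff_left hA))

theorem isForest_restrict_insert (hT : IsForest (G.restrict T)) (hl : G.IsLink e u v)
    (huv : ¬ Joined G T u v) : IsForest (G.restrict (insert e T)) := by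
  have heT : e ∉ T := fun he => huv (.of_isLink hl he)
  rw [isForest_restrict_iff] at *
  intro f hf x y hxy h
  rcases eq_or_ne f e with rfl | hfe
  · have h' : Joined G T x y := h.mono (by simp)
    rcases hl.eq_and_eq_or_eq_and_eq hxy with ⟨rfl, rfl⟩ | ⟨rfl, rfl⟩
    · exact huv h'
    · exact huv h'.symm
  · have hfT : f ∈ T := hf.resolve_left hfe
    have hxy' : Joined G T x y := .of_isLink hxy hfT
    rw [Set.insert_sdiff_of_notMem _ (by simpa using hfe.symm)] at h
    rcases h.of_insert hl with h | ⟨h, h'⟩ | ⟨h, h'⟩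
    · exact hT f hfT x y hxy h
    · exact huv (((h.mono Set.sdiff_subset).symm.trans hxy').trans (h'.mono Set.sdiff_subset).symm)
    · exact huv (((h'.mono Set.sdiff_subset).trans hxy'.symm).trans (h.mono Set.sdiff_subset))

/-- In a maximal forest between `T` and `B` the ends of every edge of `B` are joined, since
otherwise the edge could be added. Starting from a given `T` allows the construction to be iterated
along a chain of edge sets. -/
theorem exists_maximal_isForest [Finite β] (hT : IsForest (G.restrict T)) (hTB : T ⊆ B) :
    ∃ T', T ⊆ T' ∧ T' ⊆ B ∧ IsForest (G.restrict T') ∧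
      ∀ x y, Joined G B x y → Joined G T' x y := by
  obtain ⟨T', hT', hmax⟩ := (Set.toFinite {T' : Set β | T' ⊆ B ∧ IsForest (G.restrict T')}
    ).exists_le_maximal ⟨hTB, hT⟩
  refine ⟨T', hT', hmax.prop.1, hmax.prop.2, fun x y h => h.of_forall_isLink fun e he a b hl => ?_⟩
  by_contra hab
  exact hab (.of_isLink hl (hmax.2 ⟨Set.insert_subset he hmax.prop.1,
    isForest_restrict_insert hmax.prop.2 hl hab⟩ (Set.subset_insert e T') (Set.mem_insert e T')))

/-- The source of all upper bounds. Removing an edge of a forest separates its ends, so `g` can be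
refined to a function that takes one more value and is still constant along the remaining edges. The
induction needs an arbitrary `g`. -/
theorem ncard_add_ncard_image_le [Finite α] [Finite β] (hTE : T ⊆ E(G))
    (hT : IsForest (G.restrict T)) {γ : Type*} (g : α → γ)
    (hg : ∀ e ∈ T, ∀ a b, G.IsLink e a b → g a = g b) :
    T.ncard + (g '' V(G)).ncard ≤ V(G).ncard := by
  induction T, Set.toFinite T using Set.Finite.induction_on generalizing γ with
  | empty => simpa using Set.ncard_image_le (Set.toFinite _)
  | @insert e T heT _ ih =>
    obtain ⟨u, v, huv⟩ := Graph.exists_isLink_of_mem_edgeSet (hTE (Set.mem_insert e T))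
    have hsep : ¬ Joined G T u v := by
      have := isForest_restrict_iff.1 hT e (Set.mem_insert e T) u v huv
      rwa [Set.insert_sdiff_self_of_notMem heT] at this
    let g' : α → γ × Prop := fun x => (g x, Joined G T u x)
    have h1 := ih ((Set.subset_insert _ _).trans hTE)
      (isForest_restrict_mono hT (Set.subset_insert _ _)) g' (by
        intro f hf a b hab
        have hj : Joined G T a b := .of_isLink hab hf
        simp only [g', Prod.mk.injEq, eq_iff_iff]
        exact ⟨hg f (Set.mem_insert_of_mem _ hf) a b hab, fun h => h.trans hj,
          fun h => h.trans hj.symm⟩)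
    -- The value `(g u, False)`, attained at `v`, is the additional one: without it the first
    -- projection still covers `g u`, through `g' u = (g u, True)`.
    have h2 : (g '' V(G)).ncard + 1 ≤ (g' '' V(G)).ncard := by
      have hmem : (g u, False) ∈ g' '' V(G) :=
        ⟨v, huv.right_mem, by
          simp [g', hsep, hg e (Set.mem_insert _ _) u v huv]⟩
      rw [← Set.ncard_sdiff_singleton_add_one hmem (Set.toFinite _)]
      have : g '' V(G) ⊆ Prod.fst '' ((g' '' V(G)) \ {(g u, False)}) := by
        rintro _ ⟨x, hx, rfl⟩
        by_cases hxu : g' x = (g u, False)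
        · refine ⟨g' u, ⟨⟨u, huv.left_mem, rfl⟩, ?_⟩, ?_⟩
          · simp [g', Joined.refl]
          · exact (congrArg Prod.fst hxu).symm
        · exact ⟨g' x, ⟨⟨x, hx, rfl⟩, hxu⟩, rfl⟩
      have := (Set.ncard_le_ncard this (Set.toFinite _)).trans (Set.ncard_image_le (Set.toFinite _))
      omega
    rw [Set.ncard_insert_of_notMem heT (Set.toFinite _)]
    omega

/-- An edge lowers the number of components by at most one; acyclicity plays no role in this
direction. -/
theorem ncard_vertexSet_le [Finite α] [Finite β] (hTE : T ⊆ E(G)) :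
    V(G).ncard ≤ T.ncard + (components (G.restrict T)).ncard := by
  induction T, Set.toFinite T using Set.Finite.induction_on with
  | empty =>
    rw [Set.ncard_empty, zero_add]
    refine Set.ncard_le_ncard_of_injOn (component (G.restrict ∅))
      (fun x hx => mem_components_restrict.2 ⟨x, hx, rfl⟩) (fun x _ y _ h => ?_)
      (Set.toFinite _)
    exact (component_restrict_eq_iff.1 h).eq_of_forall_isLink (g := id) (by simp)
  | @insert e T heT _ ih =>
    obtain ⟨u, v, huv⟩ := Graph.exists_isLink_of_mem_edgeSet (hTE (Set.mem_insert e T))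
    have h1 := ih ((Set.subset_insert _ _).trans hTE)
    have h2 : (components (G.restrict T)).ncard ≤
        (components (G.restrict (insert e T))).ncard + 1 := by
      have hmem : component (G.restrict T) u ∈ components (G.restrict T) :=
        mem_components_restrict.2 ⟨u, huv.left_mem, rfl⟩
      rw [← Set.ncard_sdiff_singleton_add_one hmem (Set.toFinite _)]
      -- Among the old components other than that of `u`, no two are merged by the edge `uv`, so
      -- passing to the enclosing new component is injective on them.
      refine Nat.add_le_add_right (Set.ncard_le_ncard_of_injOn
        (fun C => {y | ∃ x ∈ C, Joined G (insert e T) x y}) ?_ ?_ (Set.toFinite _)) 1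
      · rintro C ⟨hC, -⟩
        obtain ⟨x, hx, rfl⟩ := mem_components_restrict.1 hC
        refine mem_components_restrict.2 ⟨x, hx, ?_⟩
        ext y
        exact ⟨fun h => ⟨x, Joined.refl x, h⟩, fun ⟨z, hz, h⟩ =>
          (Joined.mono hz (Set.subset_insert _ _)).trans h⟩
      · rintro C ⟨hC, hCu⟩ D ⟨hD, hDu⟩ hCD
        obtain ⟨x, hx, rfl⟩ := mem_components_restrict.1 hC
        obtain ⟨y, hy, rfl⟩ := mem_components_restrict.1 hD
        simp only [Set.mem_singleton_iff, component_restrict_eq_iff] at hCu hDu ⊢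
        have hmem : y ∈ {z | ∃ w ∈ component (G.restrict T) y, Joined G (insert e T) w z} :=
          ⟨y, Joined.refl y, Joined.refl y⟩
        replace hmem : y ∈ {z | ∃ w ∈ component (G.restrict T) x, Joined G (insert e T) w z} :=
          (Set.ext_iff.1 hCD y).2 hmem
        obtain ⟨w, hw, hwy⟩ := hmem
        have hxy : Joined G (insert e T) x y := (Joined.mono hw (Set.subset_insert _ _)).trans hwy
        rcases hxy.of_insert huv with h | ⟨h, -⟩ | ⟨-, h⟩
        · exact h
        · exact absurd h hCu
        · exact absurd h.symm hDu
    rw [Set.ncard_insert_of_notMem heT (Set.toFinite _)]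
    omega

theorem ncard_add_ncard_components [Finite α] [Finite β] (hTE : T ⊆ E(G))
    (hT : IsForest (G.restrict T)) :
    T.ncard + (components (G.restrict T)).ncard = V(G).ncard := by
  refine le_antisymm ?_ (ncard_vertexSet_le hTE)
  have := ncard_add_ncard_image_le hTE hT (component (G.restrict T))
    fun e he a b h => component_restrict_eq_iff.2 (.of_isLink h he)
  simpa [components] using this

/-- A forest with all its edges in the vertex set `W`, along whose edges `f` is constant. -/
theorem ncard_add_ncard_image_le_of_subset [Finite α] [Finite β] (hTE : T ⊆ E(G))
    (hT : IsForest (G.restrict T)) {W : Set α} (hWV : W ⊆ V(G))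
    (hW : ∀ e ∈ T, ∀ a, G.Inc e a → a ∈ W) {γ : Type*} (f : α → γ)
    (hf : ∀ e ∈ T, ∀ a b, G.IsLink e a b → f a = f b) :
    T.ncard + (f '' W).ncard ≤ W.ncard := by
  classical
  -- Each vertex outside `W` is its own value, so the bound over `V(G)` turns into one over `W`
  -- without loss.
  let g : α → α ⊕ γ := fun x => if x ∈ W then .inr (f x) else .inl x
  have h := ncard_add_ncard_image_le hTE hT g (by
    intro e he a b hl
    simp only [g, hW e he a hl.inc_left, hW e he b hl.inc_right, if_true, hf e he a b hl])
  have himg : g '' V(G) = Sum.inl '' (V(G) \ W) ∪ Sum.inr '' (f '' W) := by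
    rw [← Set.sdiff_union_of_subset hWV, Set.image_union, Set.union_sdiff_right, Set.image_image]
    congr 1
    · rw [Set.sdiff_sdiff, Set.union_self]
      exact Set.image_congr fun x hx => by simp [g, hx.2]
    · exact Set.image_congr fun x hx => by simp [g, hx]
  rw [himg, Set.ncard_union_eq (by
      rw [Set.disjoint_left]; rintro _ ⟨_, -, rfl⟩ ⟨_, -, h⟩; cases h) (Set.toFinite _)
      ((Set.toFinite _)),
    Set.ncard_image_of_injective _ Sum.inl_injective,
    Set.ncard_image_of_injective _ Sum.inr_injective] at h
  have := Set.ncard_sdiff_add_ncard_of_subset hWV (Set.toFinite _)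
  omega

/-- A connected set of vertices is spanned by a forest. -/
theorem ncard_le_of_joined [Finite α] [Finite β] (hTE : T ⊆ E(G)) (hT : IsForest (G.restrict T))
    {W : Set α} (hWV : W ⊆ V(G)) (hW : ∀ x ∈ W, ∀ y ∈ W, Joined G T x y) :
    W.ncard ≤ T.ncard + 1 := by
  have h := ncard_add_ncard_components hTE hT
  have h2 : (components (G.restrict T)).ncard ≤ (V(G) \ W).ncard + 1 := by
    have : components (G.restrict T) ⊆ component (G.restrict T) '' (V(G) \ W) ∪
        component (G.restrict T) '' W := by
      rw [← Set.image_union, Set.sdiff_union_of_subset hWV]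
      exact fun C hC => hC
    refine (Set.ncard_le_ncard this (Set.toFinite _)).trans ((Set.ncard_union_le _ _).trans
      (Nat.add_le_add (Set.ncard_image_le (Set.toFinite _)) ?_))
    refine (Set.ncard_le_one (Set.toFinite _)).2 ?_
    rintro _ ⟨x, hx, rfl⟩ _ ⟨y, hy, rfl⟩
    exact component_restrict_eq_iff.2 (hW x hx y hy)
  have := Set.ncard_sdiff_add_ncard_of_subset hWV (Set.toFinite _)
  omega

/-- In a forest, the removal of some edge in `B` separates any two vertices that are not joined
without edges in `B`. -/
theorem exists_separating_edge [Finite β] (hT : IsForest (G.restrict T)) (hAB : A ∪ B ⊆ T)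
    (h : Joined G (A ∪ B) x y) (hA : ¬ Joined G A x y) :
    ∃ e ∈ B, ¬ Joined G (T \ {e}) x y := by
  -- A minimal `X` joining `x` and `y` plays the role of the path; it is not contained in `A`, so it
  -- has an edge in `B`.
  obtain ⟨X, hXle, hX⟩ := (Set.toFinite {X : Set β | X ⊆ A ∪ B ∧ Joined G X x y}
    ).exists_le_minimal ⟨subset_rfl, h⟩
  have hXA : ¬ X ⊆ A := fun hXA => hA (hX.prop.2.mono hXA)
  obtain ⟨e, heX, heA⟩ := Set.not_subset.1 hXA
  have heB : e ∈ B := (hX.prop.1 heX).resolve_left heA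
  have hns : ¬ Joined G (X \ {e}) x y := fun hj =>
    (hX.2 ⟨Set.sdiff_subset.trans hX.prop.1, hj⟩ Set.sdiff_subset heX).2 rfl
  refine ⟨e, heB, fun hj => ?_⟩
  have hXT : X \ {e} ⊆ T \ {e} := Set.sdiff_subset_sdiff_left (hX.prop.1.trans hAB)
  have hX2 : Joined G (insert e (X \ {e})) x y := by
    rw [Set.insert_sdiff_singleton, Set.insert_eq_of_mem heX]; exact hX.prop.2
  by_cases heE : e ∈ E(G)
  · obtain ⟨u, v, huv⟩ := Graph.exists_isLink_of_mem_edgeSet heE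
    have hsep := isForest_restrict_iff.1 hT e (hAB (.inr heB)) u v huv
    rcases hX2.of_insert huv with h | ⟨h, h'⟩ | ⟨h, h'⟩
    · exact hns h
    · exact hsep (((h.mono hXT).symm.trans hj).trans (h'.mono hXT).symm)
    · exact hsep (((h'.mono hXT).trans hj.symm).trans (h.mono hXT))
  -- `T` may contain labels that are not edges of `G`. Such a label occurs in no walk, so minimality
  -- excludes it from `X`.
  · refine hns (hX.prop.2.of_forall_isLink fun f hf a b hl => .of_isLink hl ⟨hf, ?_⟩)
    rintro rfl
    exact heE hl.edge_mem

end Forests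

/-! ### The subgraphs of a region -/

section Subgraphs

variable {α β : Type*} {G : Graph α β} {γ δ σ : Set (α ⊕ β)} {v w : α} {e : β}

open scoped Graph

@[simp] theorem incidence_adj_inl_inr : (incidence G).Adj (Sum.inl v) (Sum.inr e) ↔ G.Inc e v := by
  simp [incidence]

@[simp] theorem incidence_adj_inr_inl : (incidence G).Adj (Sum.inr e) (Sum.inl v) ↔ G.Inc e v := by
  simp [incidence]

@[simp] theorem not_incidence_adj_inl_inl : ¬ (incidence G).Adj (Sum.inl v) (Sum.inl w) := by
  simp [incidence]

@[simp] theorem not_incidence_adj_inr_inr {f : β} :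
    ¬ (incidence G).Adj (Sum.inr e) (Sum.inr f) := by
  simp [incidence]

/-- A walk in the incidence graph alternates between vertices and edges and so is a walk in `G`.
Endpoints outside `γ` of a reached edge are included: they are the places where `γ` is attached.
Only the reached edges must lie in `A`, which covers connected components of `γ` as well as `γ`
itself. -/
theorem joined_of_reachable {A : Set β} (hv : Sum.inl v ∈ γ)
    (hA : ∀ e, ∀ he : Sum.inr e ∈ γ,
      ((incidence G).induce γ).Reachable ⟨Sum.inl v, hv⟩ ⟨Sum.inr e, he⟩ → e ∈ A)
    {b : γ} (h : ((incidence G).induce γ).Reachable ⟨Sum.inl v, hv⟩ b) :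
    (∀ w, b.1 = Sum.inl w → Joined G A v w) ∧
      ∀ e, b.1 = Sum.inr e → ∀ w, G.Inc e w → Joined G A v w := by
  have h' := h
  rw [SimpleGraph.reachable_iff_reflTransGen] at h'
  induction h' with
  | refl =>
    refine ⟨fun w hw => ?_, fun e he => by simp at he⟩
    obtain rfl : v = w := by simpa using hw
    exact .refl _
  | @tail b c hb hbc ih =>
    rw [← SimpleGraph.reachable_iff_reflTransGen] at hb
    have ih := ih hb
    obtain ⟨b | b, hbγ⟩ := b <;> obtain ⟨c | c, hcγ⟩ := c <;>
      simp only [SimpleGraph.comap_adj, Function.Embedding.subtype_apply, not_incidence_adj_inl_inl,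
        incidence_adj_inl_inr, incidence_adj_inr_inl, not_incidence_adj_inr_inr] at hbc
    · refine ⟨by simp, ?_⟩
      rintro e he w hw
      obtain rfl : c = e := by simpa using he
      exact (ih.1 b rfl).trans (.of_inc hbc hw (hA c hcγ h))
    · refine ⟨?_, by simp⟩
      rintro w hw
      obtain rfl : c = w := by simpa using hw
      exact ih.2 b rfl c hbc

theorem IsConnected.joined (h : IsConnected G γ) (hv : v ∈ verts γ) (hw : w ∈ verts γ) :
    Joined G (edges γ) v w :=
  (joined_of_reachable hv (fun _ he _ => he)
    (h.preconnected ⟨Sum.inl v, hv⟩ ⟨Sum.inl w, hw⟩)).1 w rfl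

theorem IsConnected.joined_of_inc (h : IsConnected G γ) (hv : v ∈ verts γ) (he : e ∈ edges γ)
    (hw : G.Inc e w) : Joined G (edges γ) v w :=
  (joined_of_reachable hv (fun _ he _ => he)
    (h.preconnected ⟨Sum.inl v, hv⟩ ⟨Sum.inr e, he⟩)).2 e rfl w hw

theorem IsComponentOf.subset (h : IsComponentOf G γ σ) : σ ⊆ γ := by
  obtain ⟨c, rfl⟩ := h
  rintro _ ⟨a, -, rfl⟩
  exact a.2

theorem IsComponentOf.mem_of_adj (h : IsComponentOf G γ σ) {a b : α ⊕ β} (ha : a ∈ σ) (hb : b ∈ γ)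
    (hab : (incidence G).Adj a b) : b ∈ σ := by
  obtain ⟨c, rfl⟩ := h
  obtain ⟨a, ha, rfl⟩ := ha
  refine ⟨⟨b, hb⟩, ?_, rfl⟩
  rw [SimpleGraph.ConnectedComponent.mem_supp_iff] at *
  rw [← ha, SimpleGraph.ConnectedComponent.eq]
  exact SimpleGraph.Adj.reachable (by simpa using hab.symm)

theorem IsComponentOf.joined_of_inc (h : IsComponentOf G γ σ) (hv : v ∈ verts σ) (he : e ∈ edges σ)
    (hw : G.Inc e w) : Joined G (edges σ) v w := by
  obtain ⟨c, rfl⟩ := h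
  obtain ⟨⟨_, hvγ⟩, hv, rfl⟩ := hv
  obtain ⟨⟨_, heγ⟩, he, rfl⟩ := he
  rw [SimpleGraph.ConnectedComponent.mem_supp_iff] at hv he
  refine (joined_of_reachable hvγ (fun f hf hr => ?_)
    (SimpleGraph.ConnectedComponent.eq.1 (hv.trans he.symm))).2 e rfl w hw
  refine ⟨⟨Sum.inr f, hf⟩, ?_, rfl⟩
  rw [SimpleGraph.ConnectedComponent.mem_supp_iff, ← hv, SimpleGraph.ConnectedComponent.eq]
  exact hr.symm

theorem exists_isComponentOf {a : α ⊕ β} (ha : a ∈ γ) : ∃ σ, IsComponentOf G γ σ ∧ a ∈ σ :=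
  ⟨Subtype.val '' (((incidence G).induce γ).connectedComponentMk ⟨a, ha⟩).supp, ⟨_, rfl⟩,
    ⟨a, ha⟩, rfl, rfl⟩

theorem IsComponentOf.eq_of_mem {τ : Set (α ⊕ β)} (hσ : IsComponentOf G γ σ)
    (hτ : IsComponentOf G γ τ) {a : α ⊕ β} (haσ : a ∈ σ) (haτ : a ∈ τ) : σ = τ := by
  obtain ⟨c, rfl⟩ := hσ
  obtain ⟨d, rfl⟩ := hτ
  obtain ⟨a, hac, rfl⟩ := haσ
  obtain ⟨b, hbd, hab⟩ := haτ
  obtain rfl := Subtype.ext hab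
  rw [SimpleGraph.ConnectedComponent.mem_supp_iff] at hac hbd
  rw [← hac, ← hbd]

/-- No edge is dropped, because all endpoints lie in `γ`, and there is a single component. -/
theorem loops_toGraph [Finite α] (hγ : ∀ e ∈ edges γ, e ∈ E(G) ∧ ∀ v, G.Inc e v → v ∈ verts γ)
    (hne : (verts γ).Nonempty) (hc : IsConnected G γ) :
    loops (toGraph G γ) = (edges γ).ncard - (verts γ).ncard + 1 := by
  have hlink : ∀ e a b, (toGraph G γ).IsLink e a b ↔ e ∈ edges γ ∧ G.IsLink e a b := by
    intro e a b
    simp only [toGraph, Graph.restrict_isLink, Graph.induce_isLink]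
    exact ⟨fun h => by tauto, fun ⟨he, hl⟩ =>
      by have := (hγ e he).2 a hl.inc_left; have := (hγ e he).2 b hl.inc_right; tauto⟩
  have hE : E(toGraph G γ) = edges γ := by
    ext e
    rw [Graph.edge_mem_iff_exists_isLink]
    simp only [hlink]
    exact ⟨fun ⟨_, _, h⟩ => h.1, fun h =>
      let ⟨a, b, hl⟩ := Graph.exists_isLink_of_mem_edgeSet (hγ e h).1
      ⟨a, b, h, hl⟩⟩
  have hV : V(toGraph G γ) = verts γ := rfl
  have hcomp : components (toGraph G γ) = {verts γ} := by
    have hAdj : (toGraph G γ).Adj = (G.restrict (edges γ)).Adj := by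
      ext a b
      simp only [Graph.Adj, hlink, Graph.restrict_isLink]
    have : ∀ x ∈ verts γ, component (toGraph G γ) x = verts γ := by
      intro x hx
      ext y
      refine ⟨fun h => ?_, fun hy => ?_⟩
      · obtain rfl | ⟨z, -, h⟩ := Relation.ReflTransGen.cases_tail h
        · exact hx
        · exact hV ▸ h.right_mem
      · change Relation.ReflTransGen _ _ _
        rw [hAdj]
        exact hc.joined hx hy
    rw [components, hV]
    obtain ⟨x, hx⟩ := hne
    ext C
    simp only [Set.mem_image, Set.mem_singleton_iff]
    exact ⟨fun ⟨y, hy, h⟩ => h ▸ this y hy, fun h => ⟨x, hx, h ▸ this x hx⟩⟩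
  rw [loops, hE, hV, hcomp, Set.ncard_singleton, Nat.cast_one]

/-- Every vertex of `γ` is joined to the outside, so the contracted graph is connected, and its one
component cancels the auxiliary vertex. -/
theorem loops_contracted [Finite α] (hE : edges γ ⊆ E(G)) (hV : verts γ ⊆ V(G))
    (hne : (V(G) \ verts γ).Nonempty)
    (hγ : ∀ v ∈ verts γ, ∃ w ∈ V(G) \ verts γ, Joined G (edges γ) v w) :
    loops (contracted G γ) = (edges γ).ncard - (verts γ).ncard := by
  classical
  have hEc : E(contracted G γ) = edges γ := by
    simp [contracted, Set.inter_eq_right.2 hE]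
  set f : α → Option α := fun v => if v ∈ verts γ then some v else none
  have hVc : V(contracted G γ) = insert none (some '' verts γ) := by
    have h0 : V(contracted G γ) = f '' V(G) := by
      simp only [contracted, Graph.vertexSet_map, Graph.vertexSet_restrict]
      refine Set.image_congr fun x _ => ?_
      simp only [f]
    rw [h0]
    ext y
    constructor
    · rintro ⟨x, hx, rfl⟩
      by_cases h : x ∈ verts γ <;> simp [f, h]
    · rintro (rfl | ⟨x, hx, rfl⟩)
      · obtain ⟨w, hw, hw'⟩ := hne
        exact ⟨w, hw, by simp [f, hw']⟩
      · exact ⟨x, hV hx, by simp [f, hx]⟩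
  have hjoin : ∀ x y, Joined G (edges γ) x y →
      Relation.ReflTransGen (contracted G γ).Adj (f x) (f y) := by
    intro x y h
    exact Relation.ReflTransGen.lift (p := (contracted G γ).Adj) f
      (fun a b ⟨e, hab⟩ => ⟨e, a, b, hab, by simp only [f], by simp only [f]⟩) x y h
  have hnone : ∀ x ∈ V(contracted G γ), Relation.ReflTransGen (contracted G γ).Adj x none := by
    rw [hVc]
    rintro _ (rfl | ⟨x, hx, rfl⟩)
    · exact .refl
    · obtain ⟨w, hw, hxw⟩ := hγ x hx
      have := hjoin x w hxw
      simpa [f, hx, hw.2] using this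
  have hcomp : components (contracted G γ) = {component (contracted G γ) none} := by
    ext C
    simp only [components, Set.mem_image, Set.mem_singleton_iff]
    constructor
    · rintro ⟨x, hx, rfl⟩
      have hx := hnone x hx
      have hx' := Relation.ReflTransGen.stdSymm.symm _ _ hx
      exact Set.ext fun y => ⟨fun h => hx'.trans h, fun h => hx.trans h⟩
    · rintro rfl
      exact ⟨none, hVc ▸ Set.mem_insert _ _, rfl⟩
  rw [loops, hEc, hVc, hcomp, Set.ncard_singleton, Set.ncard_insert_of_notMem (by simp)
    (Set.toFinite _), Set.ncard_image_of_injective _ (Option.some_injective _)]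
  push_cast
  ring

end Subgraphs

/-! ### Hard, jet and soft parts: incidence, connectivity, loop numbers -/

section Regions

variable {α β : Type*} {K M : ℕ} {G : Graph α β} {attach : Leg K M → α} {mode : β → Mode K}
  {σ : Set (α ⊕ β)} {v w : α} {e : β}

open scoped Graph

@[simp] theorem verts_hardPart : verts (hardPart G mode) = hardVerts G mode := by
  ext; simp [verts, hardPart]

@[simp] theorem verts_jetPart (i : Fin K) : verts (jetPart G mode i) = jetVerts G mode i := by
  ext; simp [verts, jetPart]

@[simp] theorem verts_softPart : verts (softPart G mode) = softVerts G mode := by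
  ext; simp [verts, softPart]

@[simp] theorem mem_edges_hardPart :
    e ∈ edges (hardPart G mode) ↔ e ∈ E(G) ∧ mode e = Mode.hard := by
  simp [edges, hardPart]

@[simp] theorem mem_edges_jetPart {i : Fin K} :
    e ∈ edges (jetPart G mode i) ↔ e ∈ E(G) ∧ mode e = Mode.jet i := by
  simp [edges, jetPart]

@[simp] theorem mem_edges_softPart :
    e ∈ edges (softPart G mode) ↔ e ∈ E(G) ∧ mode e = Mode.soft := by
  simp [edges, softPart]

/-- The vertices outside the soft subgraph. -/
def lowVerts (G : Graph α β) (mode : β → Mode K) : Set α :=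
  hardVerts G mode ∪ ⋃ i, jetVerts G mode i

/-- The edges outside the soft subgraph. -/
def lowEdges (G : Graph α β) (mode : β → Mode K) : Set β :=
  edges (hardPart G mode) ∪ ⋃ i, edges (jetPart G mode i)

theorem hardVerts_subset : hardVerts G mode ⊆ V(G) := fun _ h => h.1

theorem jetVerts_subset (i : Fin K) : jetVerts G mode i ⊆ V(G) := fun _ h => h.1

theorem lowVerts_subset : lowVerts G mode ⊆ V(G) :=
  Set.union_subset hardVerts_subset (Set.iUnion_subset jetVerts_subset)

theorem disjoint_hardVerts_jetVerts (i : Fin K) :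
    Disjoint (hardVerts G mode) (jetVerts G mode i) :=
  Set.disjoint_left.2 fun _ h => h.2.2 i

theorem disjoint_jetVerts {i j : Fin K} (hij : i ≠ j) :
    Disjoint (jetVerts G mode i) (jetVerts G mode j) := by
  refine Set.disjoint_left.2 fun v ⟨_, ⟨e, he, hei⟩, _⟩ ⟨_, _, h⟩ => ?_
  rcases h e he with h | h
  · rw [hei] at h; cases h; exact hij rfl
  · rw [hei] at h; cases h

theorem disjoint_lowVerts_softVerts : Disjoint (lowVerts G mode) (softVerts G mode) := by
  refine Set.disjoint_left.2 fun v hv hs => ?_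
  rcases hv with hv | hv
  · exact hv.2.1 hs
  · obtain ⟨i, _, ⟨e, he, hei⟩, _⟩ := Set.mem_iUnion.1 hv
    rw [hs.2.2 e he] at hei
    cases hei

theorem lowVerts_union_softVerts : lowVerts G mode ∪ softVerts G mode = V(G) := by
  refine Set.Subset.antisymm (Set.union_subset lowVerts_subset fun _ h => h.1) fun v hv => ?_
  by_cases hs : v ∈ softVerts G mode
  · exact .inr hs
  by_cases hj : ∃ i, v ∈ jetVerts G mode i
  · exact .inl (.inr (Set.mem_iUnion.2 hj))
  · exact .inl (.inl ⟨hv, hs, fun i hi => hj ⟨i, hi⟩⟩)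

theorem mem_hardVerts_of_inc (he : mode e = Mode.hard) (hv : G.Inc e v) :
    v ∈ hardVerts G mode := by
  refine ⟨hv.vertex_mem, fun hs => ?_, fun i hi => ?_⟩
  · have := hs.2.2 e hv
    rw [he] at this; cases this
  · rcases hi.2.2 e hv with h | h <;> rw [he] at h <;> cases h

/-- A vertex where an edge of the jet meets a hard edge or another jet counts as hard; so distinct
jets can touch only at `H`. -/
theorem mem_of_inc_jet {i : Fin K} (he : mode e = Mode.jet i) (hv : G.Inc e v) :
    v ∈ hardVerts G mode ∨ v ∈ jetVerts G mode i := by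
  by_contra! h
  refine h.1 ⟨hv.vertex_mem, fun hs => ?_, fun j hj => ?_⟩
  · have := hs.2.2 e hv
    rw [he] at this; cases this
  · rcases hj.2.2 e hv with h' | h' <;> rw [he] at h' <;> cases h'
    exact h.2 hj

theorem mem_lowVerts_of_inc (he : e ∈ lowEdges G mode) (hv : G.Inc e v) :
    v ∈ lowVerts G mode := by
  rcases he with he | he
  · exact .inl (mem_hardVerts_of_inc (mem_edges_hardPart.1 he).2 hv)
  · obtain ⟨i, hi⟩ := Set.mem_iUnion.1 he
    rcases mem_of_inc_jet (mem_edges_jetPart.1 hi).2 hv with h | h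
    · exact .inl h
    · exact .inr (Set.mem_iUnion.2 ⟨i, h⟩)

theorem IsSoftComponent.verts_subset (hσ : IsSoftComponent G mode σ) :
    verts σ ⊆ softVerts G mode := fun v hv => by
  rw [← verts_softPart]; exact IsComponentOf.subset hσ hv

theorem IsSoftComponent.edges_subset (hσ : IsSoftComponent G mode σ) :
    edges σ ⊆ edges (softPart G mode) := fun _ he => IsComponentOf.subset hσ he

theorem IsSoftComponent.mem_of_inc (hσ : IsSoftComponent G mode σ) (he : e ∈ edges σ)
    (hv : G.Inc e v) : v ∈ lowVerts G mode ∨ v ∈ verts σ := by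
  have h : v ∈ lowVerts G mode ∪ softVerts G mode := lowVerts_union_softVerts ▸ hv.vertex_mem
  refine h.imp_right fun hs => IsComponentOf.mem_of_adj hσ he ?_ (incidence_adj_inr_inl.2 hv)
  rwa [← verts_softPart] at hs

theorem IsRegion.hardVerts_nonempty (hR : IsRegion G attach mode) :
    (hardVerts G mode).Nonempty := by
  obtain ⟨⟨a, ha⟩⟩ := hR.hard_connected.nonempty
  rcases ha with ⟨v, hv, -⟩ | ⟨e, ⟨he, hm⟩, -⟩
  · exact ⟨v, hv⟩
  · obtain ⟨x, y, hl⟩ := Graph.exists_isLink_of_mem_edgeSet he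
    exact ⟨x, mem_hardVerts_of_inc hm hl.inc_left⟩

theorem IsRegion.joined_hard (hR : IsRegion G attach mode) (hv : v ∈ hardVerts G mode)
    (hw : w ∈ hardVerts G mode) : Joined G (edges (hardPart G mode)) v w := by
  rw [← verts_hardPart] at hv hw
  exact hR.hard_connected.joined hv hw

theorem IsRegion.joined_jet (hR : IsRegion G attach mode) {i : Fin K}
    (hv : v ∈ jetVerts G mode i) :
    ∃ w ∈ hardVerts G mode, Joined G (edges (jetPart G mode i)) v w := by
  rw [← verts_jetPart] at hv
  have hne : (jetPart G mode i).Nonempty := ⟨_, hv⟩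
  obtain ⟨a, ha, b, hb, hab⟩ := hR.jet_attached i hne
  rcases b with b | b
  · rcases a with a | a
    · simp at hab
    · refine ⟨b, by rwa [← verts_hardPart], (hR.jet_connected i hne).joined_of_inc hv ha ?_⟩
      simpa using hab
  · rcases a with a | a
    -- A hard edge never ends at a jet vertex, so the attachment is by a jet edge that ends in `H`.
    · have h1 : a ∈ hardVerts G mode :=
        mem_hardVerts_of_inc (mem_edges_hardPart.1 hb).2 (by simpa using hab)
      have h2 : a ∈ jetVerts G mode i := by rw [← verts_jetPart]; exact ha
      exact absurd h2 (Set.disjoint_left.1 (disjoint_hardVerts_jetVerts i) h1)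
    · simp at hab

theorem IsRegion.joined_soft (hR : IsRegion G attach mode) (hσ : IsSoftComponent G mode σ)
    (hv : v ∈ verts σ) : ∃ w ∈ lowVerts G mode, Joined G (edges σ) v w := by
  obtain ⟨a, ha, b, hb, hab⟩ := hR.soft_attached σ hσ
  rcases b with b | b
  · rcases a with a | a
    · simp at hab
    · refine ⟨b, ?_, IsComponentOf.joined_of_inc hσ hv ha (by simpa using hab)⟩
      refine hb.imp (fun h => ?_) (fun h => ?_)
      · rwa [← verts_hardPart]
      · obtain ⟨i, hi⟩ := Set.mem_iUnion.1 h
        exact Set.mem_iUnion.2 ⟨i, by rwa [← verts_jetPart]⟩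
  · rcases a with a | a
    · have h1 : a ∈ lowVerts G mode := by
        refine mem_lowVerts_of_inc (e := b) (hb.imp_right fun h => ?_) (by simpa using hab)
        obtain ⟨i, hi⟩ := Set.mem_iUnion.1 h
        exact Set.mem_iUnion.2 ⟨i, hi⟩
      exact absurd (hσ.verts_subset ha) (Set.disjoint_left.1 disjoint_lowVerts_softVerts h1)
    · simp at hab

theorem IsRegion.loops_hard [Finite α] (hR : IsRegion G attach mode) :
    loops (toGraph G (hardPart G mode)) =
      (edges (hardPart G mode)).ncard - (hardVerts G mode).ncard + 1 := by
  rw [loops_toGraph (fun e he => ⟨(mem_edges_hardPart.1 he).1, fun v hv => ?_⟩)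
    (by rw [verts_hardPart]; exact hR.hardVerts_nonempty) hR.hard_connected, verts_hardPart]
  rw [verts_hardPart]
  exact mem_hardVerts_of_inc (mem_edges_hardPart.1 he).2 hv

theorem IsRegion.loops_jet [Finite α] (hR : IsRegion G attach mode) (i : Fin K) :
    loops (contracted G (jetPart G mode i)) =
      (edges (jetPart G mode i)).ncard - (jetVerts G mode i).ncard := by
  have hd : ∀ {w}, w ∈ hardVerts G mode → w ∈ V(G) \ verts (jetPart G mode i) := fun hw =>
    ⟨hw.1, by rw [verts_jetPart]; exact hw.2.2 i⟩
  rw [loops_contracted (fun e he => (mem_edges_jetPart.1 he).1) ?_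
    (hR.hardVerts_nonempty.mono fun _ => hd) ?_, verts_jetPart]
  · rw [verts_jetPart]; exact jetVerts_subset i
  · intro v hv
    rw [verts_jetPart] at hv
    obtain ⟨w, hw, h⟩ := hR.joined_jet hv
    exact ⟨w, hd hw, h⟩

theorem IsRegion.loops_soft [Finite α] (hR : IsRegion G attach mode)
    (hσ : IsSoftComponent G mode σ) :
    loops (contracted G σ) = (edges σ).ncard - (verts σ).ncard := by
  have hd : ∀ {w}, w ∈ lowVerts G mode → w ∈ V(G) \ verts σ := fun hw =>
    ⟨lowVerts_subset hw, fun h =>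
      Set.disjoint_left.1 disjoint_lowVerts_softVerts hw (hσ.verts_subset h)⟩
  rw [loops_contracted (fun e he => (mem_edges_softPart.1 (hσ.edges_subset he)).1)
    (fun v hv => (hσ.verts_subset hv).1)
    (hR.hardVerts_nonempty.mono fun _ hw => hd (.inl hw)) ?_]
  intro v hv
  obtain ⟨w, hw, h⟩ := hR.joined_soft hσ hv
  exact ⟨w, hd hw, h⟩

theorem IsRegion.joined_low (hR : IsRegion G attach mode) (hv : v ∈ lowVerts G mode)
    (hw : w ∈ lowVerts G mode) : Joined G (lowEdges G mode) v w := by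
  have key : ∀ x ∈ lowVerts G mode, ∃ y ∈ hardVerts G mode, Joined G (lowEdges G mode) x y := by
    rintro x (hx | hx)
    · exact ⟨x, hx, .refl _⟩
    · obtain ⟨i, hi⟩ := Set.mem_iUnion.1 hx
      obtain ⟨y, hy, h⟩ := hR.joined_jet hi
      exact ⟨y, hy, h.mono fun e he => .inr (Set.mem_iUnion.2 ⟨i, he⟩)⟩
  obtain ⟨y, hy, h⟩ := key v hv
  obtain ⟨z, hz, h'⟩ := key w hw
  exact (h.trans ((hR.joined_hard hy hz).mono Set.subset_union_left)).trans h'.symm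

theorem lowEdges_subset : lowEdges G mode ⊆ E(G) := by
  refine Set.union_subset (fun e he => (mem_edges_hardPart.1 he).1) (Set.iUnion_subset fun i e he =>
    (mem_edges_jetPart.1 he).1)

theorem IsRegion.joined_all (hR : IsRegion G attach mode) (hv : v ∈ V(G))
    (hw : w ∈ V(G)) : Joined G E(G) v w := by
  have key : ∀ x ∈ V(G), ∃ y ∈ lowVerts G mode, Joined G E(G) x y := by
    intro x hx
    rw [← lowVerts_union_softVerts (mode := mode)] at hx
    rcases hx with hx | hx
    · exact ⟨x, hx, .refl _⟩
    · rw [← verts_softPart] at hx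
      obtain ⟨σ, hσ, hxσ⟩ := exists_isComponentOf (G := G) hx
      obtain ⟨y, hy, h⟩ := hR.joined_soft hσ hxσ
      exact ⟨y, hy, h.mono fun e he =>
        (mem_edges_softPart.1 (IsSoftComponent.edges_subset hσ he)).1⟩
  obtain ⟨y, hy, h⟩ := key v hv
  obtain ⟨z, hz, h'⟩ := key w hw
  exact (h.trans ((hR.joined_low hy hz).mono lowEdges_subset)).trans h'.symm

/-- A minimum spanning tree. -/
theorem IsRegion.exists_spanningTree [Finite α] [Finite β] (hR : IsRegion G attach mode) :
    ∃ T, IsSpanningKTree 1 G T ∧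
      (hardVerts G mode).ncard ≤ (T ∩ edges (hardPart G mode)).ncard + 1 ∧
      (lowVerts G mode).ncard ≤ (T ∩ lowEdges G mode).ncard + 1 := by
  have h0 : IsForest (G.restrict ∅) := isForest_restrict_iff.2 (by simp)
  -- Kruskal's algorithm: exhaust the hard edges, then the low ones, then all edges, keeping the
  -- forest already built at each stage.
  obtain ⟨T₀, -, hT₀, hF₀, hJ₀⟩ :=
    exists_maximal_isForest h0 (Set.empty_subset (edges (hardPart G mode)))
  obtain ⟨T₁, hT₀₁, hT₁, hF₁, hJ₁⟩ :=
    exists_maximal_isForest hF₀ (B := lowEdges G mode) (hT₀.trans Set.subset_union_left)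
  obtain ⟨T, hT₁₂, hT, hF, hJ⟩ := exists_maximal_isForest hF₁ (hT₁.trans lowEdges_subset)
  have hE₁ : T₁ ⊆ E(G) := hT₁₂.trans hT
  refine ⟨T, ⟨hT, hF, ?_⟩, ?_, ?_⟩
  · obtain ⟨v, hv⟩ := hR.hardVerts_nonempty
    rw [Set.ncard_eq_one]
    refine ⟨component (G.restrict T) v, Set.eq_singleton_iff_unique_mem.2
      ⟨mem_components_restrict.2 ⟨v, hv.1, rfl⟩, fun C hC => ?_⟩⟩
    obtain ⟨w, hw, rfl⟩ := mem_components_restrict.1 hC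
    exact component_restrict_eq_iff.2 (hJ _ _ (hR.joined_all hw hv.1))
  · have := ncard_le_of_joined (hT₀₁.trans hE₁) hF₀ hardVerts_subset
      fun x hx y hy => hJ₀ _ _ (hR.joined_hard hx hy)
    have := Set.ncard_le_ncard (Set.subset_inter (hT₀₁.trans hT₁₂) hT₀) (Set.toFinite _)
    omega
  · have := ncard_le_of_joined hE₁ hF₁ lowVerts_subset
      fun x hx y hy => hJ₁ _ _ (hR.joined_low hx hy)
    have := Set.ncard_le_ncard (Set.subset_inter hT₁₂ hT₁) (Set.toFinite _)
    omega

end Regions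

/-! ### Exponents of the Lee-Pomeransky polynomial -/

theorem ScalesAs.congr {f g : ℝ → ℝ} {n : ℕ} (hf : ScalesAs f n) (h : ∀ t, 0 < t → f t = g t) :
    ScalesAs g n :=
  (show g =ᶠ[𝓝[>] 0] f from eventually_nhdsWithin_of_forall fun t ht =>
    (h t ht).symm).trans_isTheta hf

theorem frequently_pow_ne_zero (n : ℕ) : ∃ᶠ t : ℝ in 𝓝[>] 0, t ^ n ≠ 0 :=
  (eventually_nhdsWithin_of_forall (s := Set.Ioi 0) fun _ ht =>
    pow_ne_zero n (ne_of_gt ht)).frequently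

theorem ScalesAs.unique {f : ℝ → ℝ} {m n : ℕ} (hm : ScalesAs f m) (hn : ScalesAs f n) :
    m = n := by
  have key : ∀ {m n : ℕ}, ScalesAs f m → ScalesAs f n → ¬ m < n := by
    intro m n hm hn hlt
    have h1 : (fun t : ℝ => t ^ n) =o[𝓝[>] 0] fun t => t ^ m :=
      (isLittleO_pow_pow hlt).mono nhdsWithin_le_nhds
    exact h1.not_isBigO (frequently_pow_ne_zero n) (hm.symm.trans hn).1
  have := key hm hn
  have := key hn hm
  omega

theorem isTheta_neg_left_iff {f g : ℝ → ℝ} {l : Filter ℝ} :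
    (fun t => -f t) =Θ[l] g ↔ f =Θ[l] g := by
  rw [← isTheta_norm_left, ← isTheta_norm_left (f' := f)]
  simp only [norm_neg]

theorem not_scalesAs_of_forall_eq_zero {f : ℝ → ℝ} {n : ℕ} (h : ∀ t, 0 < t → f t = 0) :
    ¬ ScalesAs f n := by
  intro hf
  have h0 := hf.congr h
  have h1 : (fun t : ℝ => t ^ n) =ᶠ[𝓝[>] 0] 0 := isTheta_zero_left.1 h0
  obtain ⟨t, hne, ht⟩ := ((frequently_pow_ne_zero n).and_eventually h1).exists
  exact hne ht

/-! ### Kinematic factors, coefficients and weights -/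

section Polynomial

variable {α β : Type*} {d K M : ℕ} {G : Graph α β} {attach : Leg K M → α}
  {P : Leg K M → ℝ → Momentum d}

open scoped Graph

theorem msq_neg (k : Momentum d) : msq (-k) = msq k := by
  simp [msq, mdot]

theorem mdot_neg_right (k l : Momentum d) : mdot k (-l) = -mdot k l := by
  simp [mdot, Finset.sum_neg_distrib]
  ring

theorem IsSpanningKTree.exists_other {T : Set β} (hT : IsSpanningKTree 2 G T) {C : Set α}
    (hC : C ∈ components (G.restrict T)) :
    ∃ D, D ≠ C ∧ components (G.restrict T) = {C, D} ∧ ∀ x ∈ V(G), x ∈ D ↔ x ∉ C := by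
  obtain ⟨A, B, hAB, h⟩ := Set.ncard_eq_two.1 hT.2.2
  obtain ⟨D, hDC, hCD⟩ : ∃ D, D ≠ C ∧ components (G.restrict T) = {C, D} := by
    rw [h] at hC
    rcases hC with rfl | rfl
    · exact ⟨B, hAB.symm, h⟩
    · exact ⟨A, hAB, h.trans (Set.pair_comm _ _)⟩
  refine ⟨D, hDC, hCD, fun x hx => ?_⟩
  have hD : D ∈ components (G.restrict T) := by simp [hCD]
  have hx' : component (G.restrict T) x ∈ components (G.restrict T) :=
    mem_components_restrict.2 ⟨x, hx, rfl⟩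
  constructor
  · intro h1 h2
    exact hDC ((component_eq_of_mem hD h1).symm.trans (component_eq_of_mem hC h2))
  · intro h1
    rw [hCD] at hx'
    rcases hx' with h' | h'
    · exact absurd (h' ▸ Joined.refl x) h1
    · exact h' ▸ Joined.refl x

theorem momentumSq_eq (hattach : ∀ l, attach l ∈ V(G)) (hP : IsWideAngle P) {T : Set β}
    (hT : IsSpanningKTree 2 G T) {C : Set α} (hC : C ∈ components (G.restrict T)) {t : ℝ}
    (ht : 0 < t) : momentumSq G attach P T t = msq (momentumInto attach P C t) := by
  classical
  obtain ⟨D, hDC, hCD, hD⟩ := hT.exists_other hC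
  have hsum : momentumInto attach P D t = -momentumInto attach P C t := by
    rw [eq_neg_iff_add_eq_zero, ← hP.conservation t ht, add_comm,
      ← Finset.sum_filter_add_sum_filter_not Finset.univ (fun l => l ∈ legsIn attach C)]
    unfold momentumInto
    congr 1
    refine Finset.sum_congr (Finset.filter_congr fun l _ => ?_) fun _ _ => rfl
    exact hD _ (hattach l)
  rw [momentumSq, hCD, finsum_mem_pair hDC.symm, hsum, msq_neg]
  ring

theorem not_scalesAs_momentumSq (hattach : ∀ l, attach l ∈ V(G)) (hP : IsWideAngle P) {T : Set β}
    (hT : IsSpanningKTree 2 G T) {C : Set α} (hC : C ∈ components (G.restrict T))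
    (hl : legsIn attach C = ∅) (n : ℕ) : ¬ ScalesAs (momentumSq G attach P T) n :=
  not_scalesAs_of_forall_eq_zero fun t ht => by
    rw [momentumSq_eq hattach hP hT hC ht]
    simp [momentumInto, hl, msq, mdot]

theorem scalesAs_momentumSq_one (hattach : ∀ l, attach l ∈ V(G)) (hP : IsWideAngle P) {T : Set β}
    (hT : IsSpanningKTree 2 G T) {C : Set α} (hC : C ∈ components (G.restrict T)) {i : Fin K}
    (hl : legsIn attach C = {Sum.inl i}) : ScalesAs (momentumSq G attach P T) 1 :=
  (hP.on_shell i).congr fun t ht => by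
    rw [momentumSq_eq hattach hP hT hC ht]
    simp [momentumInto, hl, Finset.filter_eq']

/-- With `p_i` and `p_j` alone, `p_j = -p_i` and `p_i · p_j = -p_i²` would be of order `t`, against
the wide-angle condition. -/
theorem IsWideAngle.exists_third_leg (hP : IsWideAngle P) {i j : Fin K} (hij : i ≠ j) :
    ∃ l : Leg K M, l ≠ Sum.inl i ∧ l ≠ Sum.inl j := by
  classical
  by_contra! h
  have hmul : ScalesAs (fun t => mdot (P (Sum.inl i) t) (P (Sum.inl j) t)) 1 := by
    have h1 : ScalesAs (fun t => -msq (P (Sum.inl i) t)) 1 := (isTheta_neg_left_iff).2 (hP.on_shell i)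
    refine h1.congr fun t ht => ?_
    have hu : (Finset.univ : Finset (Leg K M)) = {Sum.inl i, Sum.inl j} := by
      ext l
      by_cases hl : l = Sum.inl i
      · simp [hl]
      · simp [h l hl]
    have := hP.conservation t ht
    rw [hu, Finset.sum_pair (by simpa using hij)] at this
    rw [← neg_eq_of_add_eq_zero_right this, mdot_neg_right, msq]
  have := hmul.unique (hP.wide_angle i j hij)
  omega

theorem IsSpanningKTree.unique {k l : ℕ} {T : Set β} (hk : IsSpanningKTree k G T)
    (hl : IsSpanningKTree l G T) : k = l :=
  hk.2.2.symm.trans hl.2.2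

variable [Fintype β]

open Classical in
theorem complExp_apply (T : Finset β) (e : β) :
    complExp G T e = if e ∈ E(G) ∧ e ∉ T then 1 else 0 := by
  rw [complExp, Finsupp.finsetSum_apply]
  simp [Finsupp.single_apply]

/-- Different trees give different monomials, so each coefficient comes from a single tree and
nothing cancels. -/
theorem complExp_injOn {S T : Finset β} (hS : (S : Set β) ⊆ E(G)) (hT : (T : Set β) ⊆ E(G))
    (h : complExp G S = complExp G T) : S = T := by
  classical
  ext e
  by_cases he : e ∈ E(G)
  · have := DFunLike.congr_fun h e
    simp only [complExp_apply] at this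
    by_cases h1 : e ∈ S <;> by_cases h2 : e ∈ T <;> simp_all
  · exact ⟨fun h => absurd (hS h) he, fun h => absurd (hT h) he⟩

open Classical in
theorem sum_coeff_complExp {k : ℕ} (c : Finset β → ℝ) {T : Finset β} (hT : (T : Set β) ⊆ E(G)) :
    (∑ S ∈ Finset.univ.filter (fun S : Finset β => IsSpanningKTree k G (S : Set β)),
      MvPolynomial.monomial (complExp G S) (c S)).coeff (complExp G T) =
      if IsSpanningKTree k G (T : Set β) then c T else 0 := by
  simp only [MvPolynomial.coeff_sum, MvPolynomial.coeff_monomial]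
  rw [Finset.sum_filter, Finset.sum_eq_single T]
  · simp
  · intro S _ hST
    by_cases hS : IsSpanningKTree k G (S : Set β)
    · rw [if_pos hS, if_neg fun h => hST (complExp_injOn hS.1 hT h)]
    · rw [if_neg hS]
  · simp

theorem coeff_leePomeransky_tree {T : Finset β} (hT : IsSpanningKTree 1 G (T : Set β)) (t : ℝ) :
    (leePomeransky G attach P t).coeff (complExp G T) = 1 := by
  classical
  rw [leePomeransky, MvPolynomial.coeff_add, symanzikU, symanzikF, MvPolynomial.coeff_neg,
    sum_coeff_complExp (fun _ => 1) hT.1,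
    sum_coeff_complExp (fun T => momentumSq G attach P T t) hT.1, if_pos hT,
    if_neg fun h => absurd (hT.unique h) (by norm_num)]
  simp

theorem coeff_leePomeransky_twoTree {T : Finset β} (hT : IsSpanningKTree 2 G (T : Set β)) (t : ℝ) :
    (leePomeransky G attach P t).coeff (complExp G T) = -momentumSq G attach P T t := by
  classical
  rw [leePomeransky, MvPolynomial.coeff_add, symanzikU, symanzikF, MvPolynomial.coeff_neg,
    sum_coeff_complExp (fun _ => 1) hT.1,
    sum_coeff_complExp (fun T => momentumSq G attach P T t) hT.1, if_pos hT,
    if_neg fun h => absurd (hT.unique h) (by norm_num)]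
  simp

theorem isExponent_tree {T : Finset β} (hT : IsSpanningKTree 1 G (T : Set β)) :
    IsExponent G attach P (complExp G T) 0 := by
  simp only [IsExponent, coeff_leePomeransky_tree hT, ScalesAs, pow_zero]
  exact isTheta_refl _ _

theorem isExponent_twoTree_iff {T : Finset β} (hT : IsSpanningKTree 2 G (T : Set β)) {n : ℕ} :
    IsExponent G attach P (complExp G T) n ↔ ScalesAs (momentumSq G attach P T) n := by
  simp only [IsExponent, coeff_leePomeransky_twoTree hT, ScalesAs]
  exact isTheta_neg_left_iff

theorem IsExponent.exists_tree {m : β →₀ ℕ} {n : ℕ} (h : IsExponent G attach P m n) :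
    ∃ T : Finset β, m = complExp G T ∧
      (IsSpanningKTree 1 G (T : Set β) ∨ IsSpanningKTree 2 G (T : Set β)) := by
  classical
  by_contra! hm
  refine not_scalesAs_of_forall_eq_zero (fun t _ => ?_) h
  rw [leePomeransky, MvPolynomial.coeff_add, symanzikU, symanzikF, MvPolynomial.coeff_neg]
  simp only [MvPolynomial.coeff_sum, MvPolynomial.coeff_monomial]
  rw [Finset.sum_eq_zero, Finset.sum_eq_zero, neg_zero, add_zero]
  · intro S hS
    exact if_neg fun h => (hm S h.symm).2 (Finset.mem_filter.1 hS).2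
  · intro S hS
    exact if_neg fun h => (hm S h.symm).1 (Finset.mem_filter.1 hS).2

theorem numIn_complExp {γ : Set (α ⊕ β)} (hγ : edges γ ⊆ E(G)) (T : Finset β) :
    (numIn γ (complExp G T) : ℤ) = (edges γ).ncard - ((T : Set β) ∩ edges γ).ncard := by
  classical
  have h1 : numIn γ (complExp G T) = (edges γ \ T).ncard := by
    rw [numIn, Set.ncard_eq_toFinset_card', Finset.card_eq_sum_ones, Finset.sum_filter,
      ← Finset.sum_filter_add_sum_filter_not Finset.univ (fun e => e ∈ edges γ \ (T : Set β))]
    rw [Finset.sum_congr (s₂ := (edges γ \ (T : Set β)).toFinset) (g := fun _ => 1) (by ext; simp),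
      Finset.sum_eq_zero (s := Finset.filter _ _), add_zero]
    · intro e he
      simp only [Finset.mem_filter, Set.mem_sdiff, not_and, not_not] at he
      by_cases h : e ∈ edges γ
      · have := he.2 h
        simp_all [complExp_apply]
      · simp [h]
    · intro e he
      simp only [Set.mem_toFinset, Set.mem_sdiff] at he
      have := hγ he.1
      have := he.2
      simp_all [complExp_apply]
  have h2 := Set.ncard_inter_add_ncard_sdiff_eq_ncard (edges γ) (T : Set β) (Set.toFinite _)
  rw [Set.inter_comm] at h2
  omega

/-- Each edge put into `T` removes its factor and so adds `-u_e`, which is 0, 1, 2 for hard, jet,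
soft edges: 2 minus one for being low minus one for being hard. The weight for `∅` is merely the
constant independent of `T`. -/
theorem weight_complExp {mode : β → Mode K} {T : Finset β} (hT : (T : Set β) ⊆ E(G)) (n : ℕ) :
    weight (regionVector mode) (complExp G T) n =
      weight (regionVector mode) (complExp G ∅) 0 + 2 * (T : Set β).ncard -
        ((T : Set β) ∩ lowEdges G mode).ncard -
        ((T : Set β) ∩ edges (hardPart G mode)).ncard + n := by
  classical
  have hcard : ∀ A : Set β, (((T : Set β) ∩ A).ncard : ℤ) = ∑ e, if e ∈ T ∧ e ∈ A then 1 else 0 := by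
    intro A
    rw [Set.ncard_eq_toFinset_card', Finset.card_eq_sum_ones, Nat.cast_sum, ← Finset.sum_filter]
    refine Finset.sum_congr (by ext; simp) fun _ _ => by simp
  have hT' : ((T : Set β).ncard : ℤ) = ∑ e, if e ∈ T then 1 else 0 := by
    simp
  have key : ∑ e, ((complExp G T e : ℕ) : ℤ) * regionVector mode e =
      ∑ e, (((complExp G ∅ e : ℕ) : ℤ) * regionVector mode e + 2 * (if e ∈ T then 1 else 0)
        - (if e ∈ T ∧ e ∈ lowEdges G mode then 1 else 0)
        - (if e ∈ T ∧ e ∈ edges (hardPart G mode) then 1 else 0)) := by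
    refine Finset.sum_congr rfl fun e _ => ?_
    by_cases he : e ∈ T
    · have heE : e ∈ E(G) := hT he
      cases hm : mode e <;>
        simp [complExp_apply, he, heE, lowEdges, hm, regionVector, Mode.exponent]
    · simp [complExp_apply, he]
  simp only [weight, key, Finset.sum_sub_distrib, Finset.sum_add_distrib, ← Finset.mul_sum, hcard,
    hT']
  push_cast
  ring

end Polynomial

/-! ### Numbers of edges of a spanning forest in the subgraphs of a region -/

theorem eq_of_sum_eq_of_le {ι : Type*} [Fintype ι] {x y : ι → ℕ} (h : ∀ i, x i ≤ y i)
    (hs : ∑ i, x i = ∑ i, y i) (i : ι) : x i = y i :=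
  (Finset.sum_eq_sum_iff_of_le fun i _ => h i).1 hs i (Finset.mem_univ i)

/-- Some index must exceed its bound; the pair bounds then keep all others within theirs, and the
sum leaves no slack. -/
theorem exists_unique_excess {ι : Type*} [Fintype ι] {x y : ι → ℕ}
    (h : ∀ i, x i ≤ y i + 1) (h2 : ∀ i j, i ≠ j → x i + x j ≤ y i + y j + 1)
    (hs : ∑ i, x i = ∑ i, y i + 1) : ∃ i, x i = y i + 1 ∧ ∀ j, j ≠ i → x j = y j := by
  classical
  obtain ⟨i, -, hi⟩ := Finset.exists_lt_of_sum_lt (s := Finset.univ) (f := y) (g := x) (by omega)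
  have hxi : x i = y i + 1 := le_antisymm (h i) hi
  refine ⟨i, hxi, fun j hj => ?_⟩
  rw [← Finset.add_sum_erase _ x (Finset.mem_univ i),
    ← Finset.add_sum_erase _ y (Finset.mem_univ i)] at hs
  refine (Finset.sum_eq_sum_iff_of_le fun k hk => ?_).1 (by omega) j
    (Finset.mem_erase.2 ⟨hj, Finset.mem_univ j⟩)
  have := h2 i k (Finset.ne_of_mem_erase hk).symm
  omega

section Counting

variable {α β : Type*} [Finite α] [Finite β] {K M : ℕ} {G : Graph α β} {attach : Leg K M → α}
  {mode : β → Mode K} {T : Set β} {C W : Set α} {σ τ : Set (α ⊕ β)}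

open scoped Graph

/-! #### Decomposition into subgraphs -/

omit [Finite α] in
theorem ncard_inter_lowEdges (T : Set β) : (T ∩ lowEdges G mode).ncard =
    (T ∩ edges (hardPart G mode)).ncard + ∑ i, (T ∩ edges (jetPart G mode i)).ncard := by
  rw [lowEdges, Set.inter_union_distrib_left, Set.inter_iUnion, Set.ncard_union_eq ?_
    (Set.toFinite _) (Set.toFinite _), Set.ncard_iUnion_of_finite (fun _ => Set.toFinite _) ?_,
    finsum_eq_sum_of_fintype]
  · intro i j hij
    refine Set.disjoint_left.2 fun e he he' => hij ?_
    have h1 := (mem_edges_jetPart.1 he.2).2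
    rw [(mem_edges_jetPart.1 he'.2).2] at h1
    cases h1; rfl
  · refine Set.disjoint_left.2 fun e he he' => ?_
    obtain ⟨i, hi⟩ := Set.mem_iUnion.1 he'
    have h1 := (mem_edges_hardPart.1 he.2).2
    rw [(mem_edges_jetPart.1 hi.2).2] at h1
    cases h1

omit [Finite β] in
theorem ncard_lowVerts : (lowVerts G mode).ncard =
    (hardVerts G mode).ncard + ∑ i, (jetVerts G mode i).ncard := by
  rw [lowVerts, Set.ncard_union_eq ?_
    (Set.toFinite _) (Set.toFinite _), Set.ncard_iUnion_of_finite (fun _ => Set.toFinite _) ?_,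
    finsum_eq_sum_of_fintype]
  · exact fun i j hij => disjoint_jetVerts hij
  · exact Set.disjoint_iUnion_right.2 disjoint_hardVerts_jetVerts

omit [Finite α] [Finite β] in
theorem disjoint_lowEdges_soft (hσ : IsSoftComponent G mode σ) :
    Disjoint (lowEdges G mode) (edges σ) := by
  refine Set.disjoint_left.2 fun e he he' => ?_
  have h1 := (mem_edges_softPart.1 (hσ.edges_subset he')).2
  rcases he with he | he
  · rw [(mem_edges_hardPart.1 he).2] at h1
    cases h1
  · obtain ⟨i, hi⟩ := Set.mem_iUnion.1 he
    rw [(mem_edges_jetPart.1 hi).2] at h1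
    cases h1

omit [Finite α] [Finite β] in
theorem disjoint_lowVerts_soft (hσ : IsSoftComponent G mode σ) :
    Disjoint (lowVerts G mode) (verts σ) :=
  disjoint_lowVerts_softVerts.mono_right hσ.verts_subset

omit [Finite α] [Finite β] in
theorem disjoint_edges_soft (hσ : IsSoftComponent G mode σ) (hτ : IsSoftComponent G mode τ)
    (hστ : σ ≠ τ) : Disjoint (edges σ) (edges τ) :=
  Set.disjoint_left.2 fun _ he he' => hστ (IsComponentOf.eq_of_mem hσ hτ he he')

omit [Finite α] [Finite β] in
theorem disjoint_verts_soft (hσ : IsSoftComponent G mode σ) (hτ : IsSoftComponent G mode τ)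
    (hστ : σ ≠ τ) : Disjoint (verts σ) (verts τ) :=
  Set.disjoint_left.2 fun _ he he' => hστ (IsComponentOf.eq_of_mem hσ hτ he he')

theorem ncard_eq_low_add_soft [Fintype {σ // IsSoftComponent G mode σ}] (hT : T ⊆ E(G)) :
    T.ncard = (T ∩ lowEdges G mode).ncard +
      ∑ σ : {σ // IsSoftComponent G mode σ}, (T ∩ edges σ.1).ncard := by
  have hTeq : T = (T ∩ lowEdges G mode) ∪
      ⋃ σ : {σ // IsSoftComponent G mode σ}, T ∩ edges σ.1 := by
    refine Set.Subset.antisymm (fun e he => ?_)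
      (Set.union_subset Set.inter_subset_left (Set.iUnion_subset fun _ => Set.inter_subset_left))
    cases hm : mode e with
    | hard => exact .inl ⟨he, .inl (mem_edges_hardPart.2 ⟨hT he, hm⟩)⟩
    | jet i => exact .inl ⟨he, .inr (Set.mem_iUnion.2 ⟨i, mem_edges_jetPart.2 ⟨hT he, hm⟩⟩)⟩
    | soft =>
      obtain ⟨σ, hσ, heσ⟩ := exists_isComponentOf (G := G)
        (show Sum.inr e ∈ softPart G mode from mem_edges_softPart.2 ⟨hT he, hm⟩)
      exact .inr (Set.mem_iUnion.2 ⟨⟨σ, hσ⟩, he, heσ⟩)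
  conv_lhs => rw [hTeq]
  rw [Set.ncard_union_eq ?_
    (Set.toFinite _) (Set.toFinite _), Set.ncard_iUnion_of_finite (fun _ => Set.toFinite _) ?_,
    finsum_eq_sum_of_fintype]
  · intro σ τ hστ
    exact (disjoint_edges_soft σ.2 τ.2 fun h => hστ (Subtype.ext h)).mono
      Set.inter_subset_right Set.inter_subset_right
  · exact Set.disjoint_iUnion_right.2 fun σ => (disjoint_lowEdges_soft σ.2).mono
      Set.inter_subset_right Set.inter_subset_right

theorem ncard_vertexSet_eq [Fintype {σ // IsSoftComponent G mode σ}] :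
    V(G).ncard = (lowVerts G mode).ncard +
      ∑ σ : {σ // IsSoftComponent G mode σ}, (verts σ.1).ncard := by
  have hVeq : V(G) = lowVerts G mode ∪ ⋃ σ : {σ // IsSoftComponent G mode σ}, verts σ.1 := by
    rw [← lowVerts_union_softVerts (mode := mode)]
    congr 1
    refine Set.Subset.antisymm (fun v hv => ?_) (Set.iUnion_subset fun σ => σ.2.verts_subset)
    rw [← verts_softPart] at hv
    obtain ⟨σ, hσ, h⟩ := exists_isComponentOf (G := G) hv
    exact Set.mem_iUnion.2 ⟨⟨σ, hσ⟩, h⟩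
  rw [hVeq, Set.ncard_union_eq ?_
    (Set.toFinite _) (Set.toFinite _), Set.ncard_iUnion_of_finite (fun _ => Set.toFinite _) ?_,
    finsum_eq_sum_of_fintype]
  · exact fun σ τ hστ => disjoint_verts_soft σ.2 τ.2 fun h => hστ (Subtype.ext h)
  · exact Set.disjoint_iUnion_right.2 fun σ => disjoint_lowVerts_soft σ.2

/-! #### Upper bounds -/

/-- The number of components of `T` that contain a vertex in `W`. -/
def numMeeting (G : Graph α β) (T : Set β) (W : Set α) : ℕ :=
  (component (G.restrict T) '' W).ncard

omit [Finite β] in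
theorem numMeeting_mono {W' : Set α} (h : W ⊆ W') : numMeeting G T W ≤ numMeeting G T W' :=
  Set.ncard_le_ncard (Set.image_mono h) (Set.toFinite _)

omit [Finite β] in
theorem one_le_numMeeting (h : W.Nonempty) : 1 ≤ numMeeting G T W :=
  (Set.ncard_pos (Set.toFinite _)).2 (h.image _)

omit [Finite β] in
theorem two_le_numMeeting (hC : C ∈ components (G.restrict T)) {x y : α} (hx : x ∈ W) (hy : y ∈ W)
    (hxC : x ∈ C) (hyC : y ∉ C) : 2 ≤ numMeeting G T W := by
  refine (Set.one_lt_ncard (Set.toFinite _)).2 ⟨_, ⟨x, hx, rfl⟩, _, ⟨y, hy, rfl⟩, fun h => hyC ?_⟩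
  rw [component_eq_of_mem hC hxC] at h
  exact h ▸ Joined.refl y

/-- The values counted are components of `T`, possibly coarser than those of `T ∩ A`, so the bound
need not be sharp; leading trees will saturate it where it matters. -/
theorem ncard_inter_add_numMeeting_le (hTE : T ⊆ E(G)) (hF : IsForest (G.restrict T)) {A : Set β}
    (hWV : W ⊆ V(G)) (hA : ∀ e ∈ A, ∀ v, G.Inc e v → v ∈ W) :
    (T ∩ A).ncard + numMeeting G T W ≤ W.ncard :=
  ncard_add_ncard_image_le_of_subset (Set.inter_subset_left.trans hTE)
    (isForest_restrict_mono hF Set.inter_subset_left) hWV (fun e he => hA e he.2) _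
    fun _ he _ _ hl => component_restrict_eq_iff.2 (.of_isLink hl he.1)

theorem hard_bound (hTE : T ⊆ E(G)) (hF : IsForest (G.restrict T)) :
    (T ∩ edges (hardPart G mode)).ncard + numMeeting G T (hardVerts G mode) ≤
      (hardVerts G mode).ncard :=
  ncard_inter_add_numMeeting_le hTE hF hardVerts_subset
    fun _ he _ hv => mem_hardVerts_of_inc (mem_edges_hardPart.1 he).2 hv

theorem low_bound (hTE : T ⊆ E(G)) (hF : IsForest (G.restrict T)) :
    (T ∩ lowEdges G mode).ncard + numMeeting G T (lowVerts G mode) ≤ (lowVerts G mode).ncard :=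
  ncard_inter_add_numMeeting_le hTE hF lowVerts_subset fun _ he _ hv => mem_lowVerts_of_inc he hv

theorem jet_bound (hTE : T ⊆ E(G)) (hF : IsForest (G.restrict T)) (i : Fin K) :
    (T ∩ edges (hardPart G mode)).ncard + (T ∩ edges (jetPart G mode i)).ncard +
      numMeeting G T (hardVerts G mode ∪ jetVerts G mode i) ≤
      (hardVerts G mode).ncard + (jetVerts G mode i).ncard := by
  have h := ncard_inter_add_numMeeting_le hTE hF
    (A := edges (hardPart G mode) ∪ edges (jetPart G mode i))
    (W := hardVerts G mode ∪ jetVerts G mode i)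
    (Set.union_subset hardVerts_subset (jetVerts_subset i)) (by
      rintro e (he | he) v hv
      · exact .inl (mem_hardVerts_of_inc (mem_edges_hardPart.1 he).2 hv)
      · exact mem_of_inc_jet (mem_edges_jetPart.1 he).2 hv)
  have hd : Disjoint (T ∩ edges (hardPart G mode)) (T ∩ edges (jetPart G mode i)) := by
    refine Set.disjoint_left.2 fun e he he' => ?_
    have h1 := (mem_edges_hardPart.1 he.2).2
    rw [(mem_edges_jetPart.1 he'.2).2] at h1
    cases h1
  rwa [Set.inter_union_distrib_left, Set.ncard_union_eq hd (Set.toFinite _) (Set.toFinite _),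
    Set.ncard_union_eq (disjoint_hardVerts_jetVerts i) (Set.toFinite _) (Set.toFinite _)] at h

/-- Edges of `σ` may end at low vertices, so `σ` is estimated jointly with the low part; it is
bounded by itself once `T ∩ lowEdges` is known. -/
theorem soft_bound (hTE : T ⊆ E(G)) (hF : IsForest (G.restrict T))
    (hσ : IsSoftComponent G mode σ) :
    (T ∩ lowEdges G mode).ncard + (T ∩ edges σ).ncard + numMeeting G T (lowVerts G mode) ≤
      (lowVerts G mode).ncard + (verts σ).ncard := by
  have h := ncard_inter_add_numMeeting_le hTE hF
    (A := lowEdges G mode ∪ edges σ) (W := lowVerts G mode ∪ verts σ)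
    (Set.union_subset lowVerts_subset fun v hv => (hσ.verts_subset hv).1) (by
      rintro e (he | he) v hv
      · exact .inl (mem_lowVerts_of_inc he hv)
      · exact hσ.mem_of_inc he hv)
  rw [Set.inter_union_distrib_left, Set.ncard_union_eq ((disjoint_lowEdges_soft hσ).mono
      Set.inter_subset_right Set.inter_subset_right) (Set.toFinite _) (Set.toFinite _),
    Set.ncard_union_eq (disjoint_lowVerts_soft hσ) (Set.toFinite _) (Set.toFinite _)] at h
  have := numMeeting_mono (G := G) (T := T)
    (Set.subset_union_left (s := lowVerts G mode) (t := verts σ))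
  omega

/-- Two soft components together obey the same kind of bound as one, so they cannot both have a
surplus of edges. -/
theorem soft_bound_pair (hTE : T ⊆ E(G)) (hF : IsForest (G.restrict T))
    (hσ : IsSoftComponent G mode σ) (hτ : IsSoftComponent G mode τ) (hστ : σ ≠ τ) :
    (T ∩ lowEdges G mode).ncard + (T ∩ edges σ).ncard + (T ∩ edges τ).ncard +
      numMeeting G T (lowVerts G mode) ≤
      (lowVerts G mode).ncard + (verts σ).ncard + (verts τ).ncard := by
  have h := ncard_inter_add_numMeeting_le hTE hF
    (A := lowEdges G mode ∪ edges σ ∪ edges τ) (W := lowVerts G mode ∪ verts σ ∪ verts τ)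
    (Set.union_subset (Set.union_subset lowVerts_subset fun v hv => (hσ.verts_subset hv).1)
      fun v hv => (hτ.verts_subset hv).1) (by
      rintro e ((he | he) | he) v hv
      · exact .inl (.inl (mem_lowVerts_of_inc he hv))
      · exact .inl (hσ.mem_of_inc he hv)
      · exact (hτ.mem_of_inc he hv).imp_left .inl)
  rw [Set.inter_union_distrib_left, Set.ncard_union_eq ((Set.disjoint_union_left.2
      ⟨disjoint_lowEdges_soft hτ, disjoint_edges_soft hσ hτ hστ⟩).mono
      Set.inter_subset_right Set.inter_subset_right) (Set.toFinite _) (Set.toFinite _),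
    Set.inter_union_distrib_left, Set.ncard_union_eq ((disjoint_lowEdges_soft hσ).mono
      Set.inter_subset_right Set.inter_subset_right) (Set.toFinite _) (Set.toFinite _),
    Set.ncard_union_eq (Set.disjoint_union_left.2 ⟨disjoint_lowVerts_soft hτ,
      disjoint_verts_soft hσ hτ hστ⟩) (Set.toFinite _) (Set.toFinite _),
    Set.ncard_union_eq (disjoint_lowVerts_soft hσ) (Set.toFinite _) (Set.toFinite _)] at h
  have := numMeeting_mono (G := G) (T := T) (Set.subset_union_left.trans
    (Set.subset_union_left (s := lowVerts G mode ∪ verts σ) (t := verts τ)))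
  omega

open Classical in
/-- The jets that have a vertex in `C`. -/
def jetsMeeting (G : Graph α β) (mode : β → Mode K) (C : Set α) : Finset (Fin K) :=
  {i | (jetVerts G mode i ∩ C).Nonempty}

omit [Finite α] [Finite β] in
theorem mem_jetsMeeting {i : Fin K} :
    i ∈ jetsMeeting G mode C ↔ ∃ v, v ∈ jetVerts G mode i ∧ v ∈ C := by
  simp only [jetsMeeting, Finset.mem_filter, Finset.mem_univ, true_and]
  rfl

open Classical in
/-- The jets that a vertex in `C` belongs to. -/
def jetLabel (G : Graph α β) (mode : β → Mode K) (C : Set α) (v : α) : Option (Set (Fin K)) :=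
  if v ∈ C then some {i | v ∈ jetVerts G mode i} else none

omit [Finite α] [Finite β] in
theorem jetLabel_of_mem {v : α} {i : Fin K} (hv : v ∈ jetVerts G mode i) (hC : v ∈ C) :
    jetLabel G mode C v = some {i} := by
  rw [jetLabel, if_pos hC]
  congr 1
  ext j
  refine ⟨fun hj => ?_, fun hj => hj ▸ hv⟩
  by_contra hji
  exact Set.disjoint_left.1 (disjoint_jetVerts hji) hj hv

omit [Finite α] [Finite β] in
-- Inside `C`, which avoids `H`, a low edge of `T` is a jet edge with both ends in that jet.
theorem jetLabel_eq_of_isLink (hC : C ∈ components (G.restrict T))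
    (hCH : Disjoint C (hardVerts G mode)) {e : β} (he : e ∈ T ∩ lowEdges G mode) {a b : α}
    (hl : G.IsLink e a b) : jetLabel G mode C a = jetLabel G mode C b := by
  have hab : a ∈ C ↔ b ∈ C := by
    obtain ⟨x, -, rfl⟩ := mem_components_restrict.1 hC
    have hj : Joined G T a b := .of_isLink hl he.1
    exact ⟨fun h => Joined.trans h hj, fun h => Joined.trans h hj.symm⟩
  by_cases ha : a ∈ C
  · have hb := hab.1 ha
    have haH := Set.disjoint_left.1 hCH ha
    have hbH := Set.disjoint_left.1 hCH hb
    rcases he.2 with h | h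
    · exact absurd (mem_hardVerts_of_inc (mem_edges_hardPart.1 h).2 hl.inc_left) haH
    · obtain ⟨i, hi⟩ := Set.mem_iUnion.1 h
      have hi := (mem_edges_jetPart.1 hi).2
      rw [jetLabel_of_mem ((mem_of_inc_jet hi hl.inc_left).resolve_left haH) ha,
        jetLabel_of_mem ((mem_of_inc_jet hi hl.inc_right).resolve_left hbH) hb]
  · rw [jetLabel, jetLabel, if_neg ha, if_neg (mt hab.2 ha)]

/-- The labels take at least one value per jet meeting `C`, and the value `none` on `H`. -/
theorem low_bound_of_disjoint (hH : (hardVerts G mode).Nonempty) (hTE : T ⊆ E(G))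
    (hF : IsForest (G.restrict T)) (hC : C ∈ components (G.restrict T))
    (hCH : Disjoint C (hardVerts G mode)) :
    (T ∩ lowEdges G mode).ncard + 1 + (jetsMeeting G mode C).card ≤ (lowVerts G mode).ncard := by
  have h := ncard_add_ncard_image_le_of_subset (Set.inter_subset_left.trans hTE)
    (isForest_restrict_mono hF Set.inter_subset_left) (T := T ∩ lowEdges G mode) lowVerts_subset
    (fun e he a ha => mem_lowVerts_of_inc he.2 ha) (jetLabel G mode C)
    fun e he a b hl => jetLabel_eq_of_isLink hC hCH he hl
  have hsub : insert none ((fun i => some {i}) '' (jetsMeeting G mode C : Set (Fin K))) ⊆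
      jetLabel G mode C '' lowVerts G mode := by
    refine Set.insert_subset ?_ ?_
    · obtain ⟨v, hv⟩ := hH
      exact ⟨v, .inl hv, if_neg (Set.disjoint_right.1 hCH hv)⟩
    · rintro _ ⟨i, hi, rfl⟩
      obtain ⟨v, hv, hvC⟩ := mem_jetsMeeting.1 hi
      exact ⟨v, .inr (Set.mem_iUnion.2 ⟨i, hv⟩), jetLabel_of_mem hv hvC⟩
  have h2 := Set.ncard_le_ncard hsub (Set.toFinite _)
  rw [Set.ncard_insert_of_notMem (by simp) (Set.toFinite _), Set.ncard_image_of_injective _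
    (fun i j hij => by simpa using hij), Set.ncard_coe_finset] at h2
  omega

/-! #### Distribution over the subgraphs -/

/-- The edge total over all jets equals the sum of the bounds for the single jets, so each bound is
attained. Here `a` is the deficit of `H`, and `s i` that of the `i`-th jet. -/
theorem jet_count {a : ℕ} {s : Fin K → ℕ}
    (hH : (T ∩ edges (hardPart G mode)).ncard + a = (hardVerts G mode).ncard)
    (hJ : (T ∩ lowEdges G mode).ncard + a + ∑ i, s i = (lowVerts G mode).ncard)
    (hb : ∀ i, (T ∩ edges (hardPart G mode)).ncard + (T ∩ edges (jetPart G mode i)).ncard +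
      (a + s i) ≤ (hardVerts G mode).ncard + (jetVerts G mode i).ncard) (i : Fin K) :
    (T ∩ edges (jetPart G mode i)).ncard + s i = (jetVerts G mode i).ncard := by
  rw [ncard_inter_lowEdges, ncard_lowVerts] at hJ
  refine eq_of_sum_eq_of_le (x := fun i => (T ∩ edges (jetPart G mode i)).ncard + s i)
    (y := fun i => (jetVerts G mode i).ncard) (fun j => ?_) ?_ i
  · have := hb j
    omega
  · rw [Finset.sum_add_distrib]
    omega

/-- Since `|T| = |V| - c` and the low part has `|V_low| - c` edges, there are as many soft edges in
`T` as soft vertices; no soft component can have more than its share. -/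
theorem soft_count {c : ℕ} (hT : IsSpanningKTree c G T)
    (hlow : (T ∩ lowEdges G mode).ncard + c = (lowVerts G mode).ncard)
    (hc : c ≤ numMeeting G T (lowVerts G mode)) (hσ : IsSoftComponent G mode σ) :
    (T ∩ edges σ).ncard = (verts σ).ncard := by
  let _ := Fintype.ofFinite {σ // IsSoftComponent G mode σ}
  have h1 := ncard_eq_low_add_soft (mode := mode) hT.1
  have h2 := ncard_vertexSet_eq (G := G) (mode := mode)
  have h3 := ncard_add_ncard_components hT.1 hT.2.1
  rw [hT.2.2] at h3
  refine eq_of_sum_eq_of_le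
    (x := fun σ : {σ // IsSoftComponent G mode σ} => (T ∩ edges σ.1).ncard)
    (y := fun σ => (verts σ.1).ncard) (fun τ => ?_) (by omega) ⟨σ, hσ⟩
  have := soft_bound hT.1 hT.2.1 τ.2
  omega

/-- Now the low part has `|V_low| - 3` edges although `T` has only two components, so the soft part
has one edge more than vertices. -/
theorem soft_count_excess (hT : IsSpanningKTree 2 G T)
    (hlow : (T ∩ lowEdges G mode).ncard + 3 = (lowVerts G mode).ncard)
    (hc : 2 ≤ numMeeting G T (lowVerts G mode)) :
    ∃ σ, IsSoftComponent G mode σ ∧ (T ∩ edges σ).ncard = (verts σ).ncard + 1 ∧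
      ∀ τ, IsSoftComponent G mode τ → τ ≠ σ → (T ∩ edges τ).ncard = (verts τ).ncard := by
  let _ := Fintype.ofFinite {σ // IsSoftComponent G mode σ}
  have h1 := ncard_eq_low_add_soft (mode := mode) hT.1
  have h2 := ncard_vertexSet_eq (G := G) (mode := mode)
  have h3 := ncard_add_ncard_components hT.1 hT.2.1
  rw [hT.2.2] at h3
  have h4 : ∀ τ : {σ // IsSoftComponent G mode σ},
      (T ∩ edges τ.1).ncard ≤ (verts τ.1).ncard + 1 := fun τ => by
    have := soft_bound hT.1 hT.2.1 τ.2
    omega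
  have h5 : ∀ σ τ : {σ // IsSoftComponent G mode σ}, σ ≠ τ → (T ∩ edges σ.1).ncard +
      (T ∩ edges τ.1).ncard ≤ (verts σ.1).ncard + (verts τ.1).ncard + 1 := fun σ τ hστ => by
    have := soft_bound_pair hT.1 hT.2.1 σ.2 τ.2 fun h => hστ (Subtype.ext h)
    omega
  obtain ⟨σ, hσ, h⟩ := exists_unique_excess h4 h5 (by omega)
  exact ⟨σ.1, σ.2, hσ, fun τ hτ hne => h ⟨τ, hτ⟩ fun h => hne (congrArg Subtype.val h)⟩

/-! #### The restriction to the hard subgraph -/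

/-- The restriction is a forest in any case, so its number of components is a matter of counting
edges. -/
theorem isSpanningKTree_hard_iff (hTE : T ⊆ E(G)) (hF : IsForest (G.restrict T)) {a : ℕ} :
    IsSpanningKTree a (toGraph G (hardPart G mode)) (T ∩ edges (hardPart G mode)) ↔
      (T ∩ edges (hardPart G mode)).ncard + a = (hardVerts G mode).ncard := by
  set H := toGraph G (hardPart G mode) with hH
  have hle : ∀ e a b, H.IsLink e a b → G.IsLink e a b := by
    intro e a b h
    simp only [hH, toGraph, Graph.restrict_isLink, Graph.induce_isLink] at h
    tauto
  have hE : T ∩ edges (hardPart G mode) ⊆ E(H) := by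
    rintro e ⟨heT, he⟩
    obtain ⟨x, y, hl⟩ := Graph.exists_isLink_of_mem_edgeSet (hTE heT)
    refine Graph.IsLink.edge_mem (x := x) (y := y) ?_
    have hx := mem_hardVerts_of_inc (mem_edges_hardPart.1 he).2 hl.inc_left
    have hy := mem_hardVerts_of_inc (mem_edges_hardPart.1 he).2 hl.inc_right
    simp only [hH, toGraph, Graph.restrict_isLink, Graph.induce_isLink, verts_hardPart]
    tauto
  have hFH : IsForest (H.restrict (T ∩ edges (hardPart G mode))) := by
    rw [isForest_restrict_iff] at hF ⊢
    intro e he x y hl hj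
    refine hF e he.1 x y (hle e x y hl) ?_
    refine Relation.ReflTransGen.mono (fun a b ⟨f, hf⟩ => ⟨f, ?_⟩) x y hj
    simp only [Graph.restrict_isLink, Set.mem_sdiff, Set.mem_inter_iff] at hf ⊢
    have := hle f a b
    tauto
  have hV : V(H).ncard = (hardVerts G mode).ncard := by
    rw [← verts_hardPart]; rfl
  have h := ncard_add_ncard_components hE hFH
  rw [hV] at h
  constructor
  · rintro ⟨-, -, h'⟩
    omega
  · exact fun h' => ⟨hE, hFH, by omega⟩

/-! #### The path between two jets -/

/-- The low edges and `σ` already suffice to join `x` and `y`, so no other soft component is on the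
path; the low edges alone do not, since the two jets have different labels. -/
theorem exists_pathEdge_iff (hT : IsSpanningKTree 2 G T) (hH : (hardVerts G mode).Nonempty)
    (hlow : (T ∩ lowEdges G mode).ncard + 3 = (lowVerts G mode).ncard)
    (hC : C ∈ components (G.restrict T)) (hCH : Disjoint C (hardVerts G mode)) {i j : Fin K}
    (hij : i ≠ j) {x y : α} (hx : x ∈ jetVerts G mode i) (hy : y ∈ jetVerts G mode j)
    (hxC : x ∈ C) (hyC : y ∈ C) (hσ : IsSoftComponent G mode σ)
    (hcard : (T ∩ edges σ).ncard = (verts σ).ncard + 1) (hτ : IsSoftComponent G mode τ) :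
    (∃ e ∈ T, e ∈ edges τ ∧ ¬ Joined G (T \ {e}) x y) ↔ τ = σ := by
  have hx' : x ∈ lowVerts G mode := .inr (Set.mem_iUnion.2 ⟨i, hx⟩)
  have hy' : y ∈ lowVerts G mode := .inr (Set.mem_iUnion.2 ⟨j, hy⟩)
  have hj : Joined G (T ∩ lowEdges G mode ∪ T ∩ edges σ) x y := by
    by_contra hn
    set A := T ∩ lowEdges G mode ∪ T ∩ edges σ with hA
    have hAT : A ⊆ T := Set.union_subset Set.inter_subset_left Set.inter_subset_left
    have hAcard : A.ncard = (T ∩ lowEdges G mode).ncard + (T ∩ edges σ).ncard :=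
      Set.ncard_union_eq ((disjoint_lowEdges_soft hσ).mono
        Set.inter_subset_right Set.inter_subset_right) (Set.toFinite _) (Set.toFinite _)
    have hclosed : ∀ {u v}, Joined G A u v → u ∈ C → v ∈ C := by
      intro u v huv hu
      rw [← component_eq_of_mem hC hu]
      exact huv.mono hAT
    have h := ncard_add_ncard_image_le_of_subset (hAT.trans hT.1)
      (isForest_restrict_mono hT.2.1 hAT) (W := lowVerts G mode ∪ verts σ)
      (Set.union_subset lowVerts_subset fun v hv => (hσ.verts_subset hv).1) (by
        rintro e (he | he) v hv
        · exact .inl (mem_lowVerts_of_inc he.2 hv)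
        · exact hσ.mem_of_inc he.2 hv)
      (component (G.restrict A)) fun e he a b hl =>
        component_restrict_eq_iff.2 (.of_isLink hl he)
    obtain ⟨z, hz⟩ := hH
    have hzC := Set.disjoint_right.1 hCH hz
    -- Otherwise `x`, `y` and a hard vertex `z` lie in three classes, while `A` has only two edges
    -- fewer than there are vertices in `lowVerts ∪ verts σ`.
    have h3 : ({component (G.restrict A) x, component (G.restrict A) y,
        component (G.restrict A) z} : Set (Set α)).ncard = 3 := by
      rw [Set.ncard_eq_three]
      refine ⟨_, _, _, ?_, ?_, ?_, rfl⟩ <;> rw [Ne, component_restrict_eq_iff]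
      · exact hn
      · exact fun h => hzC (hclosed h hxC)
      · exact fun h => hzC (hclosed h hyC)
    have h4 := Set.ncard_le_ncard (s := {component (G.restrict A) x, component (G.restrict A) y,
        component (G.restrict A) z})
      (t := component (G.restrict A) '' (lowVerts G mode ∪ verts σ)) (by
        rintro _ (rfl | rfl | rfl)
        · exact ⟨x, .inl hx', rfl⟩
        · exact ⟨y, .inl hy', rfl⟩
        · exact ⟨z, .inl (.inl hz), rfl⟩) (Set.toFinite _)
    rw [Set.ncard_union_eq (disjoint_lowVerts_soft hσ) (Set.toFinite _) (Set.toFinite _)] at h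
    omega
  constructor
  · rintro ⟨e, -, heτ, hn⟩
    by_contra hne
    refine hn (hj.mono ?_)
    rintro f (hf | hf)
    · exact ⟨hf.1, fun h => Set.disjoint_left.1 (disjoint_lowEdges_soft hτ) hf.2 (h ▸ heτ)⟩
    · exact ⟨hf.1, fun h => Set.disjoint_left.1 (disjoint_edges_soft hτ hσ hne) heτ (h ▸ hf.2)⟩
  · rintro rfl
    obtain ⟨e, he, hn⟩ := exists_separating_edge hT.2.1
      (Set.union_subset Set.inter_subset_left Set.inter_subset_left) hj (fun h => by
        have := h.eq_of_forall_isLink fun e he a b hl => jetLabel_eq_of_isLink hC hCH he hl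
        rw [jetLabel_of_mem hx hxC, jetLabel_of_mem hy hyC] at this
        exact hij (by simpa using this))
    exact ⟨e, he.1, he.2, hn⟩

end Counting

/-! ### Classification of the leading monomials -/

section Leading

variable {α β : Type*} [Fintype α] [Fintype β] {d K M : ℕ} {G : Graph α β}
  {attach : Leg K M → α} {P : Leg K M → ℝ → Momentum d} {mode : β → Mode K} {T : Finset β}
  {C : Set α} {σ : Set (α ⊕ β)}

open scoped Graph

theorem IsRegion.numIn_hard (hR : IsRegion G attach mode) {a : ℕ}
    (h : ((T : Set β) ∩ edges (hardPart G mode)).ncard + a = (hardVerts G mode).ncard) :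
    (numIn (hardPart G mode) (complExp G T) : ℤ) =
      loops (toGraph G (hardPart G mode)) + a - 1 := by
  rw [numIn_complExp (fun e he => (mem_edges_hardPart.1 he).1), hR.loops_hard]
  omega

theorem IsRegion.numIn_jet (hR : IsRegion G attach mode) {i : Fin K} {s : ℕ}
    (h : ((T : Set β) ∩ edges (jetPart G mode i)).ncard + s = (jetVerts G mode i).ncard) :
    (numIn (jetPart G mode i) (complExp G T) : ℤ) =
      loops (contracted G (jetPart G mode i)) + s := by
  rw [numIn_complExp (fun e he => (mem_edges_jetPart.1 he).1), hR.loops_jet]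
  omega

theorem IsRegion.numIn_soft (hR : IsRegion G attach mode) (hσ : IsSoftComponent G mode σ) {s : ℕ}
    (h : ((T : Set β) ∩ edges σ).ncard = (verts σ).ncard + s) :
    (numIn σ (complExp G T) : ℤ) = loops (contracted G σ) - s := by
  rw [numIn_complExp (fun e he => (mem_edges_softPart.1 (hσ.edges_subset he)).1),
    hR.loops_soft hσ]
  omega

/-- Comparison of weights with the minimum spanning tree; the number of vertices cancels, and `2 *
c` comes from `2|T| = 2|V| - 2c`. -/
theorem IsLeading.bound (hR : IsRegion G attach mode)
    (hlead : IsLeading G attach P (regionVector mode) (complExp G T)) {n c : ℕ}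
    (hn : IsExponent G attach P (complExp G T) n) (hT : IsSpanningKTree c G (T : Set β)) :
    n + (lowVerts G mode).ncard + (hardVerts G mode).ncard ≤
      2 * c + ((T : Set β) ∩ lowEdges G mode).ncard +
        ((T : Set β) ∩ edges (hardPart G mode)).ncard := by
  classical
  obtain ⟨n', hn', hmin⟩ := hlead
  obtain rfl := ScalesAs.unique hn' hn
  obtain ⟨T₀, hT₀, hhard, hlow⟩ := hR.exists_spanningTree
  rw [← Set.coe_toFinset T₀] at hT₀ hhard hlow
  have h := hmin _ _ (isExponent_tree hT₀)
  rw [weight_complExp hT.1, weight_complExp hT₀.1] at h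
  have h1 := ncard_add_ncard_components hT.1 hT.2.1
  have h2 := ncard_add_ncard_components hT₀.1 hT₀.2.1
  rw [hT.2.2] at h1
  rw [hT₀.2.2] at h2
  push_cast at h
  omega

theorem counts_of_tree (hR : IsRegion G attach mode)
    (hlead : IsLeading G attach P (regionVector mode) (complExp G T))
    (hT : IsSpanningKTree 1 G (T : Set β)) :
    ((T : Set β) ∩ edges (hardPart G mode)).ncard + 1 = (hardVerts G mode).ncard ∧
    (∀ i, ((T : Set β) ∩ edges (jetPart G mode i)).ncard = (jetVerts G mode i).ncard) ∧
    ∀ σ, IsSoftComponent G mode σ → ((T : Set β) ∩ edges σ).ncard = (verts σ).ncard := by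
  have h0 := hlead.bound hR (isExponent_tree hT) hT
  have hH := hR.hardVerts_nonempty
  have h1 := hard_bound (mode := mode) hT.1 hT.2.1
  have h2 := low_bound (mode := mode) hT.1 hT.2.1
  have m1 := one_le_numMeeting (G := G) (T := (T : Set β)) hH
  have m2 := one_le_numMeeting (G := G) (T := (T : Set β)) (W := lowVerts G mode)
    (hH.mono Set.subset_union_left)
  refine ⟨by omega, jet_count (a := 1) (s := fun _ => 0) (by omega) (by simp; omega) fun i => ?_,
    fun σ hσ => soft_count hT (by omega) m2 hσ⟩
  have := jet_bound (mode := mode) hT.1 hT.2.1 i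
  have := one_le_numMeeting (G := G) (T := (T : Set β))
    (W := hardVerts G mode ∪ jetVerts G mode i) (hH.mono Set.subset_union_left)
  omega

/-- The hard part and the low part each lack at least two edges, which uses up the `2 * 2` allowed
by leadership and leaves `n = 0`. -/
theorem counts_of_meeting (hR : IsRegion G attach mode)
    (hlead : IsLeading G attach P (regionVector mode) (complExp G T))
    (hT : IsSpanningKTree 2 G (T : Set β)) {n : ℕ} (hn : IsExponent G attach P (complExp G T) n)
    (hmeet : 2 ≤ numMeeting G T (hardVerts G mode)) :
    n = 0 ∧ ((T : Set β) ∩ edges (hardPart G mode)).ncard + 2 = (hardVerts G mode).ncard ∧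
    (∀ i, ((T : Set β) ∩ edges (jetPart G mode i)).ncard = (jetVerts G mode i).ncard) ∧
    ∀ σ, IsSoftComponent G mode σ → ((T : Set β) ∩ edges σ).ncard = (verts σ).ncard := by
  have h0 := hlead.bound hR hn hT
  have h1 := hard_bound (mode := mode) hT.1 hT.2.1
  have h2 := low_bound (mode := mode) hT.1 hT.2.1
  have m2 : 2 ≤ numMeeting G (T : Set β) (lowVerts G mode) :=
    hmeet.trans (numMeeting_mono Set.subset_union_left)
  refine ⟨by omega, by omega, jet_count (a := 2) (s := fun _ => 0) (by omega) (by simp; omega)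
    fun i => ?_, fun σ hσ => soft_count hT (by omega) m2 hσ⟩
  have := jet_bound (mode := mode) hT.1 hT.2.1 i
  have : 2 ≤ numMeeting G (T : Set β) (hardVerts G mode ∪ jetVerts G mode i) :=
    hmeet.trans (numMeeting_mono Set.subset_union_left)
  omega

omit [Fintype β] in
theorem meeting_or_disjoint (hT : IsSpanningKTree 2 G (T : Set β)) :
    2 ≤ numMeeting G T (hardVerts G mode) ∨
      ∃ C ∈ components (G.restrict (T : Set β)), Disjoint C (hardVerts G mode) := by
  by_contra! h
  obtain ⟨C, D, hCD, hcomp⟩ := Set.ncard_eq_two.1 hT.2.2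
  have hC : C ∈ components (G.restrict (T : Set β)) := by simp [hcomp]
  have hD : D ∈ components (G.restrict (T : Set β)) := by simp [hcomp]
  obtain ⟨x, hxC, hx⟩ := Set.not_disjoint_iff.1 (h.2 C hC)
  obtain ⟨y, hyD, hy⟩ := Set.not_disjoint_iff.1 (h.2 D hD)
  have := two_le_numMeeting (W := hardVerts G mode) hC hx hy hxC fun hyC =>
    hCD ((component_eq_of_mem hC hyC).symm.trans (component_eq_of_mem hD hyD))
  exact absurd this (not_le.2 h.1)

omit [Fintype α] [Fintype β] in
theorem IsRegion.mem_jetVerts_of_disjoint (hR : IsRegion G attach mode)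
    (hattach : ∀ l, attach l ∈ V(G)) (hCH : Disjoint C (hardVerts G mode)) {l : Leg K M}
    (hl : attach l ∈ C) : ∃ i, l = Sum.inl i ∧ attach (Sum.inl i) ∈ jetVerts G mode i ∧
      i ∈ jetsMeeting G mode C := by
  have hV := hattach l
  rw [← lowVerts_union_softVerts (mode := mode)] at hV
  rcases hV with (h | h) | h
  · exact absurd h (Set.disjoint_left.1 hCH hl)
  · obtain ⟨i, hi⟩ := Set.mem_iUnion.1 h
    obtain rfl := hR.jet_only_momentum i l hi
    exact ⟨i, rfl, hi, mem_jetsMeeting.2 ⟨_, hi, hl⟩⟩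
  · exact absurd h (hR.soft_momenta l)

/-- A leading spanning 2-tree with a component `C` disjoint from the hard subgraph. -/
theorem classification_of_disjoint (hattach : ∀ l, attach l ∈ V(G)) (hP : IsWideAngle P)
    (hR : IsRegion G attach mode)
    (hlead : IsLeading G attach P (regionVector mode) (complExp G T))
    (hT : IsSpanningKTree 2 G (T : Set β)) {n : ℕ} (hn : IsExponent G attach P (complExp G T) n)
    (hC : C ∈ components (G.restrict (T : Set β))) (hCH : Disjoint C (hardVerts G mode)) :
    ((n = 1 ∧ ∃ i, jetsMeeting G mode C = {i} ∧ legsIn attach C = {Sum.inl i}) ∨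
      (n = 0 ∧ ∃ i j, i ≠ j ∧ jetsMeeting G mode C = {i, j} ∧
        legsIn attach C = {Sum.inl i, Sum.inl j})) ∧
    ((T : Set β) ∩ edges (hardPart G mode)).ncard + 1 = (hardVerts G mode).ncard ∧
    ((T : Set β) ∩ lowEdges G mode).ncard + 1 + (jetsMeeting G mode C).card =
      (lowVerts G mode).ncard := by
  have h0 := hlead.bound hR hn hT
  have hH := hR.hardVerts_nonempty
  have h1 := hard_bound (mode := mode) hT.1 hT.2.1
  have m1 := one_le_numMeeting (G := G) (T := (T : Set β)) hH
  have h2 := low_bound_of_disjoint hH hT.1 hT.2.1 hC hCH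
  have hs := (isExponent_twoTree_iff hT).1 hn
  have hne : (legsIn attach C).Nonempty := by
    rw [Set.nonempty_iff_ne_empty]
    exact fun h => not_scalesAs_momentumSq hattach hP hT hC h n hs
  have hsingle : ∀ i, legsIn attach C = {Sum.inl i} → n = 1 := fun i hi =>
    hs.unique (scalesAs_momentumSq_one hattach hP hT hC hi)
  have hlegs : ∀ l ∈ legsIn attach C, ∃ i ∈ jetsMeeting G mode C, l = Sum.inl i := by
    intro l hl
    obtain ⟨i, rfl, -, hi⟩ := hR.mem_jetVerts_of_disjoint hattach hCH hl
    exact ⟨i, hi, rfl⟩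
  have hk : (jetsMeeting G mode C).card ≠ 0 := by
    obtain ⟨l, hl⟩ := hne
    obtain ⟨i, hi, -⟩ := hlegs l hl
    exact Finset.card_ne_zero_of_mem hi
  -- Leadership together with `low_bound_of_disjoint` leaves `n + k ≤ 2` for the number `k` of jets
  -- meeting `C`.
  have hk2 : (jetsMeeting G mode C).card = 1 ∨ (jetsMeeting G mode C).card = 2 := by omega
  rcases hk2 with hk | hk
  · obtain ⟨i, hi⟩ := Finset.card_eq_one.1 hk
    have hl : legsIn attach C = {Sum.inl i} := by
      refine hne.subset_singleton_iff.1 fun l hl => ?_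
      obtain ⟨j, hj, rfl⟩ := hlegs l hl
      rw [hi, Finset.mem_singleton] at hj
      rw [hj]; rfl
    have := hsingle i hl
    exact ⟨.inl ⟨this, i, hi, hl⟩, by omega, by omega⟩
  · obtain ⟨i, j, hij, hi⟩ := Finset.card_eq_two.1 hk
    have hn0 : n = 0 := by omega
    have hl : legsIn attach C ⊆ {Sum.inl i, Sum.inl j} := by
      intro l hl
      obtain ⟨k, hk, rfl⟩ := hlegs l hl
      simpa [hi] using hk
    -- No leg would make the coefficient vanish, and a single one would give `n = 1`, so both are
    -- present.
    have hl' : legsIn attach C = {Sum.inl i, Sum.inl j} := by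
      rcases Set.subset_pair_iff_eq.1 hl with h | h | h | h
      · exact absurd h hne.ne_empty
      · have := hsingle i h; omega
      · have := hsingle j h; omega
      · exact h
    exact ⟨.inr ⟨hn0, i, j, hij, hi, hl'⟩, by omega, by omega⟩

theorem jet_count_of_disjoint (hR : IsRegion G attach mode)
    (hT : IsSpanningKTree 2 G (T : Set β))
    (hC : C ∈ components (G.restrict (T : Set β))) (hCH : Disjoint C (hardVerts G mode))
    (hhard : ((T : Set β) ∩ edges (hardPart G mode)).ncard + 1 = (hardVerts G mode).ncard)
    (hlow : ((T : Set β) ∩ lowEdges G mode).ncard + 1 + (jetsMeeting G mode C).card =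
      (lowVerts G mode).ncard) (l : Fin K) :
    ((T : Set β) ∩ edges (jetPart G mode l)).ncard +
      (if l ∈ jetsMeeting G mode C then 1 else 0) = (jetVerts G mode l).ncard := by
  obtain ⟨x, hx⟩ := hR.hardVerts_nonempty
  have hxC := Set.disjoint_right.1 hCH hx
  refine jet_count (a := 1) (s := fun l => if l ∈ jetsMeeting G mode C then 1 else 0) hhard
    (by simpa using hlow) (fun l => ?_) l
  have h1 := jet_bound (mode := mode) hT.1 hT.2.1 l
  by_cases hl : l ∈ jetsMeeting G mode C
  · obtain ⟨v, hv, hvC⟩ := mem_jetsMeeting.1 hl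
    have := two_le_numMeeting (W := hardVerts G mode ∪ jetVerts G mode l) hC (.inr hv) (.inl hx)
      hvC hxC
    simp only [if_pos hl]
    omega
  · have := one_le_numMeeting (G := G) (T := (T : Set β))
      (W := hardVerts G mode ∪ jetVerts G mode l) ⟨x, .inl hx⟩
    simp only [if_neg hl]
    omega

omit [Fintype β] in
theorem two_le_numMeeting_low_of_disjoint (hR : IsRegion G attach mode)
    (hC : C ∈ components (G.restrict (T : Set β))) (hCH : Disjoint C (hardVerts G mode))
    {i : Fin K} (hi : i ∈ jetsMeeting G mode C) :
    2 ≤ numMeeting G (T : Set β) (lowVerts G mode) := by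
  obtain ⟨x, hx⟩ := hR.hardVerts_nonempty
  obtain ⟨v, hv, hvC⟩ := mem_jetsMeeting.1 hi
  exact two_le_numMeeting hC (.inr (Set.mem_iUnion.2 ⟨i, hv⟩)) (.inl hx) hvC
    (Set.disjoint_right.1 hCH hx)

theorem classification_of_isLeading (hattach : ∀ l, attach l ∈ V(G)) (hP : IsWideAngle P)
    (hR : IsRegion G attach mode) {m : β →₀ ℕ}
    (hlead : IsLeading G attach P (regionVector mode) m) :
    ∃ T : Finset β, m = complExp G T ∧
      (IsUTerm G attach P mode T ∨ (∃ i, IsFpTerm G attach P mode i T) ∨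
        IsFITerm G attach P mode T ∨ ∃ i j, i ≠ j ∧ IsFIITerm G attach P mode i j T) := by
  obtain ⟨n, hn, -⟩ := id hlead
  obtain ⟨T, rfl, hT | hT⟩ := hn.exists_tree
  · exact ⟨T, rfl, .inl ⟨hlead, hT⟩⟩
  have hs := (isExponent_twoTree_iff hT).1 hn
  refine ⟨T, rfl, .inr ?_⟩
  rcases meeting_or_disjoint (mode := mode) hT with hmeet | ⟨C, hC, hCH⟩
  · obtain ⟨rfl, hhard, -⟩ := counts_of_meeting hR hlead hT hn hmeet
    exact .inr (.inl ⟨⟨hlead, hT, hs⟩, (isSpanningKTree_hard_iff hT.1 hT.2.1).2 hhard⟩)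
  · obtain ⟨⟨-, i, -, hi⟩ | ⟨rfl, i, j, hij, -, hl⟩, hhard, -⟩ :=
      classification_of_disjoint hattach hP hR hlead hT hn hC hCH
    · exact .inl ⟨i, hlead, hT, C, hC, hi⟩
    · exact .inr (.inr ⟨i, j, hij, ⟨hlead, hT, hs⟩,
        (isSpanningKTree_hard_iff hT.1 hT.2.1).2 hhard, C, hC, hCH, hl⟩)

/-! ### From edge counts to loop numbers -/

theorem numIn_of_isUTerm (hR : IsRegion G attach mode) (h : IsUTerm G attach P mode T) :
    (numIn (hardPart G mode) (complExp G T) : ℤ) = loops (toGraph G (hardPart G mode)) ∧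
      (∀ l, (numIn (jetPart G mode l) (complExp G T) : ℤ) =
        loops (contracted G (jetPart G mode l))) ∧
      ∀ σ, IsSoftComponent G mode σ →
        (numIn σ (complExp G T) : ℤ) = loops (contracted G σ) := by
  obtain ⟨hhard, hjet, hsoft⟩ := counts_of_tree hR h.1 h.2
  refine ⟨?_, fun l => ?_, fun σ hσ => ?_⟩
  · simpa using hR.numIn_hard hhard
  · simpa using hR.numIn_jet (s := 0) (hjet l)
  · simpa using hR.numIn_soft hσ (s := 0) (hsoft σ hσ)

theorem numIn_of_isFpTerm (hattach : ∀ l, attach l ∈ V(G)) (hP : IsWideAngle P)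
    (hR : IsRegion G attach mode) {i : Fin K} (h : IsFpTerm G attach P mode i T) :
    (numIn (hardPart G mode) (complExp G T) : ℤ) = loops (toGraph G (hardPart G mode)) ∧
      (numIn (jetPart G mode i) (complExp G T) : ℤ) =
        loops (contracted G (jetPart G mode i)) + 1 ∧
      (∀ l, l ≠ i → (numIn (jetPart G mode l) (complExp G T) : ℤ) =
        loops (contracted G (jetPart G mode l))) ∧
      ∀ σ, IsSoftComponent G mode σ →
        (numIn σ (complExp G T) : ℤ) = loops (contracted G σ) := by
  obtain ⟨hlead, hT, C, hC, hl⟩ := h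
  have hn := (isExponent_twoTree_iff hT).2 (scalesAs_momentumSq_one hattach hP hT hC hl)
  rcases meeting_or_disjoint (mode := mode) hT with hmeet | ⟨D, hD, hDH⟩
  · exact absurd (counts_of_meeting hR hlead hT hn hmeet).1 one_ne_zero
  obtain ⟨⟨-, j, hj, hlj⟩ | ⟨h, -⟩, hhard, hlow⟩ :=
    classification_of_disjoint hattach hP hR hlead hT hn hD hDH
  -- The component `C` with leg `p_i` need not be the component `D` that avoids `H`. But if `D` had
  -- another leg `p_j`, the two components would carry `p_i` and `p_j` only, leaving no place for a
  -- third leg.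
  · have hij : i = j := by
      by_contra hij
      obtain ⟨l, hli, hlj'⟩ := hP.exists_third_leg hij
      obtain ⟨E, -, hCE, hE⟩ := hT.exists_other hC
      have hlC : attach l ∉ C := fun h => hli (hl.subset h)
      have hDE : D = E := by
        rw [hCE] at hD
        refine hD.resolve_left fun hDC => hij ?_
        rw [hDC, hl] at hlj
        simpa using hlj
      have hlD : attach l ∈ D := hDE ▸ (hE _ (hattach l)).2 hlC
      exact hlj' (hlj.subset hlD)
    subst hij
    have hjet := jet_count_of_disjoint hR hT hD hDH hhard hlow
    have hlow' : ((T : Set β) ∩ lowEdges G mode).ncard + 2 = (lowVerts G mode).ncard := by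
      rw [← hlow, hj, Finset.card_singleton]
    refine ⟨?_, ?_, fun l hli => ?_, fun σ hσ => ?_⟩
    · simpa using hR.numIn_hard hhard
    · exact hR.numIn_jet (s := 1) (by simpa [hj] using hjet i)
    · simpa using hR.numIn_jet (s := 0) (by simpa [hj, hli] using hjet l)
    · simpa using hR.numIn_soft hσ (s := 0) (soft_count hT hlow'
        (two_le_numMeeting_low_of_disjoint hR hD hDH (i := i) (by simp [hj])) hσ)
  · exact absurd h one_ne_zero

theorem numIn_of_isFITerm (hattach : ∀ l, attach l ∈ V(G)) (hP : IsWideAngle P)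
    (hR : IsRegion G attach mode) (h : IsFITerm G attach P mode T) :
    (numIn (hardPart G mode) (complExp G T) : ℤ) = loops (toGraph G (hardPart G mode)) + 1 ∧
      (∀ l, (numIn (jetPart G mode l) (complExp G T) : ℤ) =
        loops (contracted G (jetPart G mode l))) ∧
      ∀ σ, IsSoftComponent G mode σ →
        (numIn σ (complExp G T) : ℤ) = loops (contracted G σ) := by
  obtain ⟨⟨hlead, hT, hs⟩, hH⟩ := h
  have hn := (isExponent_twoTree_iff (attach := attach) (P := P) hT).2 hs
  have hH' := (isSpanningKTree_hard_iff hT.1 hT.2.1).1 hH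
  rcases meeting_or_disjoint (mode := mode) hT with hmeet | ⟨D, hD, hDH⟩
  · obtain ⟨-, hhard, hjet, hsoft⟩ := counts_of_meeting hR hlead hT hn hmeet
    refine ⟨?_, fun l => ?_, fun σ hσ => ?_⟩
    · rw [hR.numIn_hard hhard]
      push_cast
      ring
    · simpa using hR.numIn_jet (s := 0) (hjet l)
    · simpa using hR.numIn_soft hσ (s := 0) (hsoft σ hσ)
  -- If a component avoided `H`, the restriction to `H` would have one edge too many for a 2-tree.
  · have := (classification_of_disjoint hattach hP hR hlead hT hn hD hDH).2.1
    omega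

theorem numIn_of_isFIITerm (hattach : ∀ l, attach l ∈ V(G)) (hP : IsWideAngle P)
    (hR : IsRegion G attach mode) {i j : Fin K} (hij : i ≠ j)
    (h : IsFIITerm G attach P mode i j T) :
    (numIn (hardPart G mode) (complExp G T) : ℤ) = loops (toGraph G (hardPart G mode)) ∧
      (numIn (jetPart G mode i) (complExp G T) : ℤ) =
        loops (contracted G (jetPart G mode i)) + 1 ∧
      (numIn (jetPart G mode j) (complExp G T) : ℤ) =
        loops (contracted G (jetPart G mode j)) + 1 ∧
      (∀ l, l ≠ i → l ≠ j → (numIn (jetPart G mode l) (complExp G T) : ℤ) =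
        loops (contracted G (jetPart G mode l))) ∧
      ∃ σ, IsSoftComponent G mode σ ∧
        (∀ τ, IsSoftComponent G mode τ → (ContainsPathEdge G attach T i j τ ↔ τ = σ)) ∧
        (numIn σ (complExp G T) : ℤ) = loops (contracted G σ) - 1 ∧
        (∀ τ, IsSoftComponent G mode τ → τ ≠ σ →
          (numIn τ (complExp G T) : ℤ) = loops (contracted G τ)) := by
  obtain ⟨⟨hlead, hT, hs⟩, -, C, hC, hCH, hl⟩ := h
  have hn := (isExponent_twoTree_iff (attach := attach) (P := P) hT).2 hs
  have hiC : attach (Sum.inl i) ∈ C := hl.symm.subset (.inl rfl)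
  have hjC : attach (Sum.inl j) ∈ C := hl.symm.subset (.inr rfl)
  obtain ⟨i', hi', hiJ, hi⟩ := hR.mem_jetVerts_of_disjoint hattach hCH hiC
  obtain ⟨j', hj', hjJ, hj⟩ := hR.mem_jetVerts_of_disjoint hattach hCH hjC
  obtain rfl : i = i' := by simpa using hi'
  obtain rfl : j = j' := by simpa using hj'
  obtain ⟨hcases, hhard, hlow⟩ := classification_of_disjoint hattach hP hR hlead hT hn hC hCH
  have hcard : (jetsMeeting G mode C).card = 2 := by
    rcases hcases with ⟨-, k, hk, -⟩ | ⟨-, k, k', hkk', hk, -⟩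
    · rw [hk, Finset.mem_singleton] at hi hj
      exact absurd (hi.trans hj.symm) hij
    · rw [hk, Finset.card_pair hkk']
  have hpair : jetsMeeting G mode C = {i, j} := by
    refine (Finset.eq_of_subset_of_card_le ?_ ?_).symm
    · exact Finset.insert_subset hi (Finset.singleton_subset_iff.2 hj)
    · rw [hcard, Finset.card_pair hij]
  have hjet := jet_count_of_disjoint hR hT hC hCH hhard hlow
  -- 3 is one for the part outside `C` and one for each of the two jets that `C` meets.
  have hlow' : ((T : Set β) ∩ lowEdges G mode).ncard + 3 = (lowVerts G mode).ncard := by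
    rw [← hlow, hcard]
  obtain ⟨σ, hσ, hσc, hτc⟩ := soft_count_excess hT hlow'
    (two_le_numMeeting_low_of_disjoint hR hC hCH hi)
  refine ⟨?_, ?_, ?_, fun l hli hlj => ?_, σ, hσ, fun τ hτ => ?_, ?_, fun τ hτ hne => ?_⟩
  · simpa using hR.numIn_hard hhard
  · exact hR.numIn_jet (s := 1) (by simpa [hi] using hjet i)
  · exact hR.numIn_jet (s := 1) (by simpa [hj] using hjet j)
  · simpa using hR.numIn_jet (s := 0) (by simpa [hpair, hli, hlj] using hjet l)
  · rw [← exists_pathEdge_iff hT hR.hardVerts_nonempty hlow' hC hCH hij hiJ hjJ hiC hjC hσ hσc hτ]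
    refine and_iff_right ?_
    rw [component_eq_of_mem hC hiC]
    exact hjC
  · exact hR.numIn_soft hσ (s := 1) hσc
  · simpa using hR.numIn_soft hτ (s := 0) (hτc τ hτ hne)

end Leading

end

end WideAngle
open WideAngle in
theorem corollary3 {α β : Type*} [Fintype α] [Fintype β] {d K M : ℕ}
    (G : Graph α β) (attach : Leg K M → α) (hattach : ∀ l, attach l ∈ G.vertexSet)
    (P : Leg K M → ℝ → Momentum d) (hP : IsWideAngle P)
    (mode : β → Mode K) (hR : IsRegion G attach mode) :
    -- every leading monomial is of one of the four types
    (∀ m, IsLeading G attach P (regionVector mode) m → ∃ T : Finset β, m = complExp G T ∧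
      (IsUTerm G attach P mode T ∨ (∃ i, IsFpTerm G attach P mode i T) ∨
        IsFITerm G attach P mode T ∨ ∃ i j, i ≠ j ∧ IsFIITerm G attach P mode i j T)) ∧
    -- the terms of `U`
    (∀ T : Finset β, IsUTerm G attach P mode T →
      (numIn (hardPart G mode) (complExp G T) : ℤ) = loops (toGraph G (hardPart G mode)) ∧
      (∀ l, (numIn (jetPart G mode l) (complExp G T) : ℤ) =
        loops (contracted G (jetPart G mode l))) ∧
      (∀ σ, IsSoftComponent G mode σ →
        (numIn σ (complExp G T) : ℤ) = loops (contracted G σ))) ∧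
    -- the terms of `F` with the factor `p_i ^ 2`
    (∀ i, ∀ T : Finset β, IsFpTerm G attach P mode i T →
      (numIn (hardPart G mode) (complExp G T) : ℤ) = loops (toGraph G (hardPart G mode)) ∧
      (numIn (jetPart G mode i) (complExp G T) : ℤ) =
        loops (contracted G (jetPart G mode i)) + 1 ∧
      (∀ l, l ≠ i → (numIn (jetPart G mode l) (complExp G T) : ℤ) =
        loops (contracted G (jetPart G mode l))) ∧
      (∀ σ, IsSoftComponent G mode σ →
        (numIn σ (complExp G T) : ℤ) = loops (contracted G σ))) ∧
    -- the first type of terms of `F` with a factor of order one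
    (∀ T : Finset β, IsFITerm G attach P mode T →
      (numIn (hardPart G mode) (complExp G T) : ℤ) = loops (toGraph G (hardPart G mode)) + 1 ∧
      (∀ l, (numIn (jetPart G mode l) (complExp G T) : ℤ) =
        loops (contracted G (jetPart G mode l))) ∧
      (∀ σ, IsSoftComponent G mode σ →
        (numIn σ (complExp G T) : ℤ) = loops (contracted G σ))) ∧
    -- the second type of terms of `F` with a factor of order one
    (∀ i j, i ≠ j → ∀ T : Finset β, IsFIITerm G attach P mode i j T →
      (numIn (hardPart G mode) (complExp G T) : ℤ) = loops (toGraph G (hardPart G mode)) ∧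
      (numIn (jetPart G mode i) (complExp G T) : ℤ) =
        loops (contracted G (jetPart G mode i)) + 1 ∧
      (numIn (jetPart G mode j) (complExp G T) : ℤ) =
        loops (contracted G (jetPart G mode j)) + 1 ∧
      (∀ l, l ≠ i → l ≠ j → (numIn (jetPart G mode l) (complExp G T) : ℤ) =
        loops (contracted G (jetPart G mode l))) ∧
      ∃ σ, IsSoftComponent G mode σ ∧
        (∀ τ, IsSoftComponent G mode τ → (ContainsPathEdge G attach T i j τ ↔ τ = σ)) ∧
        (numIn σ (complExp G T) : ℤ) = loops (contracted G σ) - 1 ∧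
        (∀ τ, IsSoftComponent G mode τ → τ ≠ σ →
          (numIn τ (complExp G T) : ℤ) = loops (contracted G τ))) :=
  ⟨fun _ => classification_of_isLeading hattach hP hR,
    fun _ => numIn_of_isUTerm hR,
    fun _ _ => numIn_of_isFpTerm hattach hP hR,
    fun _ => numIn_of_isFITerm hattach hP hR,
    fun _ _ hij _ => numIn_of_isFIITerm hattach hP hR hij⟩
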